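/- Let $k\ge 1$ be an integer, $\zeta=e^{2\pi i/k}$, and let $X$ be a non-empty connected compact Hausdorff space. A *cone of angle $2\pi n/k$* ($n\ge1$) is obtained from $n$ Euclidean sectors of angle $2\pi/k$, with boundary rays $A_i,B_i$, by gluing $B_i$ isometrically to $A_{i+1}$ for $i\in\mathbb Z/n$ (so that all the centres become one point, the apex). A *$(1/k)$-translation structure* on $X$ is a finite set $S\subset X$ with a maximal atlas of $\mathbb C$-valued charts on $X\setminus S$ whose transition functions are locally of the form $z\mapsto \zeta^r z+c$ ($r\in\mathbb Z$, $c\in\mathbb C$), such that each $p\in S$ is a cone point of angle $2\pi n/k$ for some integer $n\ge 1$: there is a homeomorphism from a neighbourhood of $p$, containing no other point of $S$, onto a neighbourhood of the apex of the cone of angle $2\pi n/k$, which sends $p$ to the apex and is a (local) isometry of flat metrics away from $p$. A *$k$-differential* on $X$ is a Riemann surface structure on $X$ (a maximal holomorphic atlas) together with a not identically zero meromorphic section $\xi$ of $K_X^{k}$, i.e. locally $\xi=f(z)(dz)^k$ with $f$ meromorphic. We say that $(S,\text{atlas})$ is *induced by* $\xi$ if its charts are exactly the holomorphic charts $z$ on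 open subsets of $X\setminus S$ in which $\xi=(dz)^k$. Then: 1. Being induced gives a bijection between the $(1/k)$-translation structures on $X$ and the pairs $(\xi,S)$, where $\xi$ is a $k$-differential on $X$ all of whose poles have order at most $k-1$ and $S$ is a finite set of marked points containing all zeros and poles of $\xi$; the set of cone points is the set $S$ of marked points. 2. It also gives a bijection between the $(1/k)$-translation structures on $X$ none of whose points of $S$ has cone angle $2\pi$ and the $k$-differentials on $X$ all of whose poles have order at most $k-1$; here $S$ is exactly the set of zeros and poles of $\xi$. 3. If a $(1/k)$-translation structure with set of cone points $S$ is induced by $\xi$, then for every $p\in S$ and $m\in\mathbb Z$, $\xi$ has order $m$ at $p$ if and only if $p$ is a cone point of angle $2\pi(k+m)/k$. 4. The correspondence respects isomorphisms: if $(1/k)$-translation structures on $X$ and $Y$ (both non-empty connected compact Hausdorff spaces), with sets of cone points $S$ and $S'$, are induced by $\xi$ and $\xi'$, then a homeomorphism $f\colon X\to Y$ is an isomorphism of $(1/k)$-translation structures (it maps $S$ onto $S'$ and identifies the atlases) if and only if $f(S)=S'$, $f$ is biholomorphic and $f^*\xi'=\xi$. -/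

import Mathlib

open Set Topology
open scoped NNReal

/-! ## Maximal atlases -/

/-- `A` is a maximal atlas of `ℂ`-valued charts on the open subset `U` of `X`, where `R` says when
the change of charts from the first chart to the second one is admissible. -/
structure IsMaximalAtlas {X : Type*} [TopologicalSpace X] (U : Set X)
    (R : OpenPartialHomeomorph X ℂ → OpenPartialHomeomorph X ℂ → Prop)
    (A : Set (OpenPartialHomeomorph X ℂ)) : Prop where
  source_subset : ∀ e ∈ A, e.source ⊆ U
  cover : ∀ x ∈ U, ∃ e ∈ A, x ∈ e.source
  compatible : ∀ e ∈ A, ∀ e' ∈ A, R e e'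
  maximal : ∀ e : OpenPartialHomeomorph X ℂ, e.source ⊆ U →
    (∀ e' ∈ A, R e e' ∧ R e' e) → e ∈ A

/-- The change of charts `e' ∘ e⁻¹` is holomorphic. -/
def HolomorphicTransition {X : Type*} [TopologicalSpace X]
    (e e' : OpenPartialHomeomorph X ℂ) : Prop :=
  DifferentiableOn ℂ (fun z => e' (e.symm z)) (e.symm.trans e').source

/-- The change of charts `e' ∘ e⁻¹` is locally of the form `z ↦ ζ ^ r * z + c` with
`ζ = exp (2 π i / k)`, `r ∈ ℤ` and `c ∈ ℂ`. -/
def KTranslationTransition {X : Type*} [TopologicalSpace X] (k : ℕ)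
    (e e' : OpenPartialHomeomorph X ℂ) : Prop :=
  ∀ z ∈ (e.symm.trans e').source, ∃ (r : ℤ) (c : ℂ), ∀ᶠ w in 𝓝 z,
    e' (e.symm w) = Complex.exp (2 * Real.pi * Complex.I / k) ^ r * w + c

/-! ## Cones -/

/-- A point `(i, r, u)` of the disjoint union of `n` sectors of angle `2 π / k`: it lies in the
`i`-th sector, at distance `r` from the centre, and the angle between the first boundary ray `A_i`
and the segment to the point is `2 π u / k`. So `u = 0` is the ray `A_i` and `u = 1` is the
ray `B_i`. The triples with `r = 0` all stand for the centre and are glued together below. The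
radius is not bounded, since only neighbourhoods of the centre will matter. The number `n` is
positive in all uses. -/
abbrev SectorPoint (n : ℕ) : Type := ZMod n × ℝ≥0 × unitInterval

/-- The gluing of the sectors: all the centres are identified, and the ray `B_i` is identified
isometrically with the ray `A_{i+1}`, the indices being taken modulo `n`. -/
inductive SectorGluing (n : ℕ) : SectorPoint n → SectorPoint n → Prop
  | center (i j : ZMod n) (u v : unitInterval) : SectorGluing n (i, 0, u) (j, 0, v)
  | ray (i : ZMod n) (r : ℝ≥0) : SectorGluing n (i, r, 1) (i + 1, r, 0)

/-- The cone obtained by gluing cyclically `n` sectors, with the quotient topology. -/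
def Cone (n : ℕ) : Type := Quot (SectorGluing n)

instance (n : ℕ) : TopologicalSpace (Cone n) :=
  inferInstanceAs (TopologicalSpace (Quot (SectorGluing n)))

/-- The cone point. -/
def Cone.apex (n : ℕ) : Cone n := Quot.mk _ (0, 0, 0)

/-- Polar coordinates on the cone glued from `n` sectors of angle `2 π / k`: the point at
distance `r` from the apex and total angle `t`, measured from the ray `A_0` through the successive
sectors. It is periodic in `t` with period `2 π n / k`. -/
noncomputable def Cone.polar (k n : ℕ) (x : ℝ≥0 × ℝ) : Cone n :=
  Quot.mk _ ((⌊k * x.2 / (2 * Real.pi)⌋ : ℤ), x.1,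
    ⟨Int.fract (k * x.2 / (2 * Real.pi)), Int.fract_nonneg _, (Int.fract_lt_one _).le⟩)

/-- The point of the Euclidean plane with polar coordinates `(r, t)`. -/
noncomputable def planePolar (x : ℝ≥0 × ℝ) : ℂ :=
  (x.1 : ℝ) * Complex.exp (x.2 * Complex.I)

/-- Given a set `S` of singular points and an atlas `A` of `X \ S` with isometric changes of
charts, `p` is a cone point of angle `2 π n / k`: there is a homeomorphism `h` from an open
neighbourhood of `p` that contains no other singular point, to an open neighbourhood of the apex
of the cone made of `n` sectors of angle `2 π / k`, which sends `p` to the apex and is a (local)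
isometry away from `p`. The flat metric of `X \ S` is read in the charts `e ∈ A`, and the flat
metric of the cone at a point different from the apex is read by developing a neighbourhood of
this point in the plane, that is, by using `Cone.polar` and `planePolar`. -/
def IsConePoint {X : Type*} [TopologicalSpace X] (k : ℕ) (S : Set X)
    (A : Set (OpenPartialHomeomorph X ℂ)) (p : X) (n : ℕ) : Prop :=
  0 < n ∧ ∃ h : OpenPartialHomeomorph X (Cone n),
    p ∈ h.source ∧ h p = Cone.apex n ∧ h.source ∩ S ⊆ {p} ∧
    ∀ e ∈ A, ∀ x : ℝ≥0 × ℝ, 0 < x.1 → Cone.polar k n x ∈ h.target →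
      h.symm (Cone.polar k n x) ∈ e.source →
      ∃ V ∈ 𝓝 x, ∀ y ∈ V, ∀ y' ∈ V,
        dist (e (h.symm (Cone.polar k n y))) (e (h.symm (Cone.polar k n y'))) =
          dist (planePolar y) (planePolar y')

/-! ## `(1/k)`-translation surfaces -/

/-- A `(1/k)`-translation structure on the space `X`: a finite set `sing` of points, a (maximal)
atlas of `X \ sing` with changes of charts of type `z ↦ ζ ^ r * z + c`, such that every point
of `sing` is a cone point of angle `2 π n / k` for some `n ≥ 1`. -/
@[ext]
structure TranslationSurface (k : ℕ) (X : Type*) [TopologicalSpace X] where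
  sing : Set X
  atlas : Set (OpenPartialHomeomorph X ℂ)
  sing_finite : sing.Finite
  isMaximalAtlas : IsMaximalAtlas singᶜ (KTranslationTransition k) atlas
  isConePoint : ∀ p ∈ sing, ∃ n : ℕ, IsConePoint k sing atlas p n

/-- The point `p` is a cone point of angle `α`. -/
def TranslationSurface.IsConePointOfAngle {k : ℕ} {X : Type*} [TopologicalSpace X]
    (T : TranslationSurface k X) (p : X) (α : ℝ) : Prop :=
  ∃ n : ℕ, α = 2 * Real.pi * n / k ∧ IsConePoint k T.sing T.atlas p n

/-- The homeomorphism `f` is an isomorphism of `(1/k)`-translation surfaces. -/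
def TranslationSurface.IsIso {k : ℕ} {X Y : Type*} [TopologicalSpace X] [TopologicalSpace Y]
    (T : TranslationSurface k X) (T' : TranslationSurface k Y) (f : X ≃ₜ Y) : Prop :=
  f '' T.sing = T'.sing ∧
    ∀ e : OpenPartialHomeomorph Y ℂ, e ∈ T'.atlas ↔ f.transOpenPartialHomeomorph e ∈ T.atlas

/-! ## `k`-differentials -/

/-- A Riemann surface structure on the space `X` together with a non-zero meromorphic
`k`-differential `ξ` on it. The Riemann surface structure is a maximal holomorphic atlas. In a
chart `e` with coordinate `z`, one has `ξ = coeff e z * (dz) ^ k`, where `coeff e` is meromorphic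
on the target of `e`. Since the value of a meromorphic function at a pole has no meaning, `coeff e`
is normalised to be analytic wherever it can be and to vanish at its poles (this
is `MeromorphicNFOn`), and to vanish outside the target of `e`. -/
@[ext]
structure KDifferential (k : ℕ) (X : Type*) [TopologicalSpace X] where
  atlas : Set (OpenPartialHomeomorph X ℂ)
  coeff : OpenPartialHomeomorph X ℂ → ℂ → ℂ
  isMaximalAtlas : IsMaximalAtlas univ HolomorphicTransition atlas
  meromorphic : ∀ e ∈ atlas, MeromorphicNFOn (coeff e) e.target
  transform : ∀ e ∈ atlas, ∀ e' ∈ atlas, ∀ z ∈ (e.symm.trans e').source,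
    coeff e z = coeff e' (e' (e.symm z)) * deriv (fun w => e' (e.symm w)) z ^ k
  coeff_eq_zero : ∀ e z, (e ∉ atlas ∨ z ∉ e.target) → coeff e z = 0
  ne_zero : ∃ e ∈ atlas, ∃ z ∈ e.target, coeff e z ≠ 0

namespace KDifferential

/-- The order of `ξ` at `p` is `m` (computed in any chart around `p`). -/
def HasOrder {k : ℕ} {X : Type*} [TopologicalSpace X] (D : KDifferential k X) (p : X) (m : ℤ) :
    Prop :=
  ∀ e ∈ D.atlas, p ∈ e.source → meromorphicOrderAt (D.coeff e) (e p) = m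

/-- All the poles of `ξ` have order at most `k - 1`, that is, the order of `ξ` is at least
`-(k - 1)` at every point. -/
def PoleOrdersLE {k : ℕ} {X : Type*} [TopologicalSpace X] (D : KDifferential k X) : Prop :=
  ∀ p : X, ∀ e ∈ D.atlas, p ∈ e.source →
    ((-((k : ℤ) - 1) : ℤ) : WithTop ℤ) ≤ meromorphicOrderAt (D.coeff e) (e p)

/-- The homeomorphism `f : X → Y` is biholomorphic and pulls the `k`-differential of `Y` back to
the one of `X`. -/
def IsIso {k : ℕ} {X Y : Type*} [TopologicalSpace X] [TopologicalSpace Y]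
    (D : KDifferential k X) (D' : KDifferential k Y) (f : X ≃ₜ Y) : Prop :=
  (∀ e : OpenPartialHomeomorph Y ℂ, e ∈ D'.atlas ↔ f.transOpenPartialHomeomorph e ∈ D.atlas) ∧
    ∀ e ∈ D'.atlas, ∀ z ∈ e.target, D.coeff (f.transOpenPartialHomeomorph e) z = D'.coeff e z

end KDifferential

/-- A `k`-differential with a finite set of marked points, which contains all its zeros and
poles (and possibly also points of order `0`). -/
@[ext]
structure PointedKDifferential (k : ℕ) (X : Type*) [TopologicalSpace X] extends
    KDifferential k X where
  marked : Set X
  marked_finite : marked.Finite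
  hasOrder_zero : ∀ p ∉ marked, toKDifferential.HasOrder p 0

/-- The `(1/k)`-translation surface `T` is the one given by the `k`-differential `ξ`: the
translation charts of `T` are exactly the holomorphic charts on the complement of the singular
points in which `ξ = (dz) ^ k`. -/
def TranslationSurface.IsInducedBy {k : ℕ} {X : Type*} [TopologicalSpace X]
    (T : TranslationSurface k X) (D : KDifferential k X) : Prop :=
  T.atlas = {e | e ∈ D.atlas ∧ e.source ⊆ T.singᶜ ∧ ∀ z ∈ e.target, D.coeff e z = 1}

/-!
The cone of angle `2 π n / k` is mapped homeomorphically to the plane by multiplying the angle and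
raising the radius to the power `k / n`. In the logarithmic coordinate `l = log r + i t` this map
is `w = exp (k l / n)`, while the developing map of the flat metric is `exp l`; so every local
question about cones becomes one about functions of `l` on a half plane, without branches of roots
(`isConePoint_iff_exists_planeChart`).

From translation structures to differentials: near a cone point, a translation chart read in the
coordinate `l` has the same distances as `exp`, so it is `a * exp + b` or `a * conj exp + b` with
`|a| = 1` (`exists_motion_of_dist_eq`). The half plane is connected, so the orientation and `a ^ k`
are constant, and after a reflection if needed `w` is a coordinate in which the translation charts
are holomorphic and `(dz) ^ k = c * w ^ (n - k) * (dw) ^ k` (`IsConePoint.exists_isConeChart`). All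
charts compatible with the translation charts then form a Riemann surface structure, by removable
singularities, and the `k`-differential extends meromorphically to the cone points with order
`n - k`. It is determined outside a finite set by `ξ = (dz) ^ k`, hence everywhere.

From differentials to translation structures: at a point of order `n - k > -k` there is a
holomorphic coordinate `v` with `ξ = (n / k) ^ k * v ^ (n - k) * (dv) ^ k`
(`exists_normalForm_coordinate`). It is found by integrating a branch of `ξ ^ (1 / k)`, which
amounts to solving `(n / k) * H + z * H' = φ` by power series, and by taking a root. For `n = k`
this is a translation chart, and in general the flat metric in the coordinate `v` is that of the
cone (`IsConeChart.isConePoint`). Changes of translation charts have derivatives that are `k`-th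
roots of unity, hence are locally `z ↦ ζ ^ r * z + c`.

Finally, connectedness and compactness make the set of zeros and poles finite, so that it can serve
as the set of cone points of a `k`-differential without marked points.
-/

/-! ### The cone as a plane -/

/-- The map from the disjoint union of `n` sectors of angle `2 π / k` to the plane that opens or
closes the cone to total angle `2 π`: the angle is multiplied by `k / n` and the radius is raised
to the power `k / n`, so that the map is conformal away from the centres. -/
noncomputable def sectorToPlane (k n : ℕ) [NeZero n] (x : SectorPoint n) : ℂ :=
  (((x.2.1 : ℝ) ^ ((k : ℝ) / n) : ℝ) : ℂ) *
    (ZMod.stdAddChar x.1 * Complex.exp (2 * Real.pi * Complex.I * ((x.2.2 : ℝ) : ℂ) / n))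

lemma norm_sectorToPlane (k n : ℕ) [NeZero n] (x : SectorPoint n) :
    ‖sectorToPlane k n x‖ = (x.2.1 : ℝ) ^ ((k : ℝ) / n) := by
  have h1 : ‖Complex.exp (2 * Real.pi * Complex.I * ((x.2.2 : ℝ) : ℂ) / n)‖ = 1 := by
    have : (2 * Real.pi * Complex.I * ((x.2.2 : ℝ) : ℂ) / n) =
        ((2 * Real.pi * (x.2.2 : ℝ) / n : ℝ) : ℂ) * Complex.I := by
      push_cast; ring
    rw [this, Complex.norm_exp_ofReal_mul_I]
  have h2 : ‖(ZMod.stdAddChar x.1 : ℂ)‖ = 1 := by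
    rw [ZMod.stdAddChar_apply, Circle.norm_coe]
  rw [sectorToPlane, norm_mul, norm_mul, h1, h2, mul_one, mul_one, Complex.norm_real,
    Real.norm_of_nonneg (by positivity)]

lemma continuous_sectorToPlane {k n : ℕ} [NeZero n] : Continuous (sectorToPlane k n) := by
  unfold sectorToPlane
  have h1 : Continuous fun x : SectorPoint n => (ZMod.stdAddChar x.1 : ℂ) :=
    (continuous_of_discreteTopology (f := fun i : ZMod n => (ZMod.stdAddChar i : ℂ))).comp
      continuous_fst
  have h2 : Continuous fun x : SectorPoint n => (x.2.1 : ℝ) ^ ((k : ℝ) / n) :=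
    (Real.continuous_rpow_const (by positivity)).comp (by fun_prop)
  fun_prop

lemma sectorToPlane_eq_of_gluing {k n : ℕ} [NeZero n] (hk : 0 < k) (x y : SectorPoint n)
    (h : SectorGluing n x y) : sectorToPlane k n x = sectorToPlane k n y := by
  have hkn : (k : ℝ) / n ≠ 0 := by
    have : n ≠ 0 := NeZero.ne n
    positivity
  cases h with
  | center i j u v => simp [sectorToPlane, Real.zero_rpow hkn]
  | ray i r =>
    have h1 : (ZMod.stdAddChar (1 : ZMod n) : ℂ) = Complex.exp (2 * Real.pi * Complex.I / n) := by
      simpa using ZMod.stdAddChar_coe (N := n) 1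
    simp [sectorToPlane, AddChar.map_add_eq_mul, h1]

/-- The conformal map from the cone to the plane induced by `sectorToPlane`. -/
noncomputable def Cone.toPlane {k n : ℕ} [NeZero n] (hk : 0 < k) : Cone n → ℂ :=
  Quot.lift (sectorToPlane k n) (sectorToPlane_eq_of_gluing hk)

lemma Cone.toPlane_polar {k n : ℕ} [NeZero n] (hk : 0 < k) (x : ℝ≥0 × ℝ) :
    Cone.toPlane hk (Cone.polar k n x) = (((x.1 : ℝ) ^ ((k : ℝ) / n) : ℝ) : ℂ) *
      Complex.exp ((((k : ℝ) / n * x.2 : ℝ) : ℂ) * Complex.I) := by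
  have hn : (n : ℂ) ≠ 0 := by exact_mod_cast NeZero.ne n
  have hpi : (Real.pi : ℂ) ≠ 0 := by exact_mod_cast Real.pi_ne_zero
  change sectorToPlane k n _ = _
  simp only [sectorToPlane, ZMod.stdAddChar_coe]
  rw [← Complex.exp_add]
  congr 2
  have : (((⌊k * x.2 / (2 * Real.pi)⌋ : ℤ) : ℝ) + Int.fract (k * x.2 / (2 * Real.pi))) =
      k * x.2 / (2 * Real.pi) := Int.floor_add_fract _
  have h2 : (((⌊k * x.2 / (2 * Real.pi)⌋ : ℤ) : ℂ) +
      ((Int.fract (k * x.2 / (2 * Real.pi)) : ℝ) : ℂ)) = k * x.2 / (2 * Real.pi) := by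
    exact_mod_cast congrArg (fun t : ℝ => (t : ℂ)) this
  calc _ = 2 * Real.pi * Complex.I / n * (((⌊k * x.2 / (2 * Real.pi)⌋ : ℤ) : ℂ) +
      ((Int.fract (k * x.2 / (2 * Real.pi)) : ℝ) : ℂ)) := by ring
    _ = _ := by rw [h2]; push_cast; field_simp

lemma Cone.exists_polar_eq {k n : ℕ} [NeZero n] (hk : 0 < k) (c : Cone n) :
    ∃ x : ℝ≥0 × ℝ, Cone.polar k n x = c := by
  have key : ∀ (i : ZMod n) (r : ℝ≥0) (u : unitInterval), (u : ℝ) < 1 →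
      ∃ x : ℝ≥0 × ℝ, Cone.polar k n x = Quot.mk _ (i, r, u) := by
    intro i r u hu
    have hk' : (k : ℝ) ≠ 0 := by positivity
    have hval : (k : ℝ) * (2 * Real.pi * ((i.val : ℤ) + (u : ℝ)) / k) / (2 * Real.pi) =
        ((i.val : ℤ) : ℝ) + u := by
      field_simp
    have hfl : ⌊((i.val : ℤ) : ℝ) + (u : ℝ)⌋ = (i.val : ℤ) := by
      rw [Int.floor_eq_iff]
      exact ⟨by linarith [u.2.1], by linarith⟩
    refine ⟨(r, 2 * Real.pi * ((i.val : ℤ) + (u : ℝ)) / k), ?_⟩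
    unfold Cone.polar
    simp only [hval]
    congr 2
    · rw [hfl]; simp
    · congr 1
      apply Subtype.ext
      simp only [Int.fract, hfl]
      ring
  obtain ⟨⟨i, r, u⟩, rfl⟩ := Quot.exists_rep c
  rcases lt_or_eq_of_le u.2.2 with hu | hu
  · exact key i r u hu
  · obtain ⟨x, hx⟩ := key (i + 1) r 0 (by simp)
    refine ⟨x, hx.trans ?_⟩
    have : u = 1 := Subtype.ext hu
    subst this
    exact (Quot.sound (SectorGluing.ray i r)).symm

lemma Cone.toPlane_injective {k n : ℕ} [NeZero n] (hk : 0 < k) :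
    Function.Injective (Cone.toPlane (n := n) hk) := by
  have hn : (n : ℝ) ≠ 0 := by exact_mod_cast NeZero.ne n
  have hkn : (0 : ℝ) < (k : ℝ) / n := by
    have : n ≠ 0 := NeZero.ne n
    positivity
  intro c d h
  obtain ⟨⟨r, t⟩, rfl⟩ := Cone.exists_polar_eq hk c
  obtain ⟨⟨s, t'⟩, rfl⟩ := Cone.exists_polar_eq hk d
  rw [Cone.toPlane_polar, Cone.toPlane_polar] at h
  have hnorm := congrArg norm h
  simp only [norm_mul, Complex.norm_exp_ofReal_mul_I, mul_one, Complex.norm_real] at hnorm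
  rw [Real.norm_of_nonneg (by positivity), Real.norm_of_nonneg (by positivity)] at hnorm
  have hrs : r = s := by
    have := (Real.rpow_left_inj r.2 s.2 hkn.ne').1 hnorm
    exact NNReal.coe_injective this
  subst hrs
  by_cases hr : r = 0
  · subst hr
    exact Quot.sound (SectorGluing.center _ _ _ _)
  · have hr0 : (((r : ℝ) ^ ((k : ℝ) / n) : ℝ) : ℂ) ≠ 0 := by
      have : 0 < (r : ℝ) := by positivity
      exact_mod_cast (Real.rpow_pos_of_pos this _).ne'
    obtain ⟨m, hm⟩ := Complex.exp_eq_exp_iff_exists_int.1 (mul_left_cancel₀ hr0 h)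
    have hm' : (k : ℝ) / n * t = (k : ℝ) / n * t' + m * (2 * Real.pi) := by
      have h3 : (((k : ℝ) / n * t : ℝ) : ℂ) * Complex.I =
          (((k : ℝ) / n * t' + m * (2 * Real.pi) : ℝ) : ℂ) * Complex.I := by
        rw [hm]; push_cast; ring
      exact_mod_cast mul_right_cancel₀ Complex.I_ne_zero h3
    have ht : (k : ℝ) * t / (2 * Real.pi) = k * t' / (2 * Real.pi) + ((m * n : ℤ) : ℝ) := by
      have hpi := Real.pi_pos
      push_cast
      field_simp at hm' ⊢
      linarith
    unfold Cone.polar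
    simp only [ht, Int.floor_add_intCast, Int.fract_add_intCast]
    simp
    rfl

lemma Cone.toPlane_surjective {k n : ℕ} [NeZero n] (hk : 0 < k) :
    Function.Surjective (Cone.toPlane (n := n) hk) := by
  have hn : (n : ℝ) ≠ 0 := by exact_mod_cast NeZero.ne n
  have hk' : (k : ℝ) ≠ 0 := by positivity
  intro z
  refine ⟨Cone.polar k n (Real.toNNReal (‖z‖ ^ ((n : ℝ) / k)), (n : ℝ) / k * z.arg), ?_⟩
  rw [Cone.toPlane_polar]
  have h1 : ((‖z‖ ^ ((n : ℝ) / k)) ^ ((k : ℝ) / n)) = ‖z‖ := by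
    rw [← Real.rpow_mul (norm_nonneg _)]
    have : (n : ℝ) / k * (k / n) = 1 := by field_simp
    rw [this, Real.rpow_one]
  have h2 : (k : ℝ) / n * ((n : ℝ) / k * z.arg) = z.arg := by field_simp
  rw [Real.coe_toNNReal _ (by positivity), h1, h2]
  exact Complex.norm_mul_exp_arg_mul_I z

lemma isProperMap_sectorToPlane {k n : ℕ} [NeZero n] (hk : 0 < k) :
    IsProperMap (sectorToPlane k n) := by
  have hkn : (0 : ℝ) < (k : ℝ) / n := by
    have : n ≠ 0 := NeZero.ne n
    positivity
  rw [isProperMap_iff_isCompact_preimage]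
  refine ⟨continuous_sectorToPlane, fun K hK => ?_⟩
  obtain ⟨M, hM⟩ := hK.isBounded.exists_norm_le
  have hcpt : IsCompact ((univ : Set (ZMod n)) ×ˢ
      (Icc (0 : ℝ≥0) (Real.toNNReal (|M| ^ ((k : ℝ) / n)⁻¹)) ×ˢ (univ : Set unitInterval))) :=
    isCompact_univ.prod (isCompact_Icc.prod isCompact_univ)
  refine hcpt.of_isClosed_subset (hK.isClosed.preimage continuous_sectorToPlane) ?_
  rintro ⟨i, r, u⟩ hx
  refine ⟨mem_univ _, ⟨zero_le, ?_⟩, mem_univ _⟩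
  have h1 := hM _ hx
  rw [norm_sectorToPlane] at h1
  apply NNReal.le_toNNReal_of_coe_le
  have h2 : (r : ℝ) ^ ((k : ℝ) / n) ≤ |M| := h1.trans (le_abs_self M)
  calc (r : ℝ) = ((r : ℝ) ^ ((k : ℝ) / n)) ^ ((k : ℝ) / n)⁻¹ := by
        rw [← Real.rpow_mul r.coe_nonneg, mul_inv_cancel₀ hkn.ne', Real.rpow_one]
    _ ≤ _ := Real.rpow_le_rpow (by positivity) h2 (by positivity)

/-- The conformal map from the cone to the plane is a homeomorphism. -/
noncomputable def Cone.planeHomeomorph {k n : ℕ} [NeZero n] (hk : 0 < k) : Cone n ≃ₜ ℂ :=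
  IsHomeomorph.homeomorph (Cone.toPlane hk) <| by
    rw [isHomeomorph_iff_continuous_isClosedMap_bijective]
    refine ⟨continuous_quot_lift _ continuous_sectorToPlane, fun C hC => ?_,
      Cone.toPlane_injective hk, Cone.toPlane_surjective hk⟩
    have h1 : IsClosed ((Quot.mk (SectorGluing n)) ⁻¹' C) :=
      IsClosed.preimage continuous_quot_mk hC
    have h2 := (isProperMap_sectorToPlane (k := k) (n := n) hk).isClosedMap _ h1
    convert h2 using 1
    ext z
    constructor
    · rintro ⟨c, hc, rfl⟩
      obtain ⟨x, rfl⟩ := Quot.exists_rep c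
      exact ⟨x, hc, rfl⟩
    · rintro ⟨x, hx, rfl⟩
      exact ⟨_, hx, rfl⟩

lemma Cone.planeHomeomorph_apex {k n : ℕ} [NeZero n] (hk : 0 < k) :
    Cone.planeHomeomorph (n := n) hk (Cone.apex n) = 0 := by
  have hkn : (k : ℝ) / n ≠ 0 := by
    have : n ≠ 0 := NeZero.ne n
    positivity
  change sectorToPlane k n (0, 0, 0) = 0
  simp [sectorToPlane, Real.zero_rpow hkn]

/-- The point with logarithmic polar coordinate `l = log r + i t`. -/
noncomputable def expPolar (l : ℂ) : ℝ≥0 × ℝ := (Real.toNNReal (Real.exp l.re), l.im)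

lemma coe_expPolar_fst (l : ℂ) : ((expPolar l).1 : ℝ) = Real.exp l.re :=
  Real.coe_toNNReal _ (Real.exp_pos _).le

lemma expPolar_snd (l : ℂ) : (expPolar l).2 = l.im := rfl

lemma continuous_expPolar : Continuous expPolar := by
  unfold expPolar
  fun_prop

lemma expPolar_fst_pos (l : ℂ) : 0 < (expPolar l).1 :=
  Real.toNNReal_pos.2 (Real.exp_pos l.re)

lemma planePolar_expPolar (l : ℂ) : planePolar (expPolar l) = Complex.exp l := by
  rw [planePolar, coe_expPolar_fst, expPolar_snd, Complex.ofReal_exp,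
    ← Complex.exp_add, Complex.re_add_im]

/-- The logarithmic coordinate of a point of the plane in polar coordinates. -/
noncomputable def logPolar (x : ℝ≥0 × ℝ) : ℂ := Real.log x.1 + x.2 * Complex.I

lemma expPolar_logPolar {x : ℝ≥0 × ℝ} (hx : 0 < x.1) : expPolar (logPolar x) = x := by
  ext
  · simp [coe_expPolar_fst, logPolar, Real.exp_log (show (0 : ℝ) < x.1 from hx)]
  · simp [expPolar_snd, logPolar]

lemma continuousAt_logPolar {x : ℝ≥0 × ℝ} (hx : 0 < x.1) : ContinuousAt logPolar x := by
  unfold logPolar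
  have h1 : ContinuousAt (fun y : ℝ≥0 × ℝ => Real.log (y.1 : ℝ)) x := by
    exact ContinuousAt.log (by fun_prop) (show (0 : ℝ) < x.1 from hx).ne'
  have h2 : ContinuousAt (fun y : ℝ≥0 × ℝ => ((Real.log (y.1 : ℝ) : ℝ) : ℂ)) x :=
    Complex.continuous_ofReal.continuousAt.comp h1
  exact h2.add (by fun_prop)

lemma Cone.planeHomeomorph_polar_expPolar {k n : ℕ} [NeZero n] (hk : 0 < k) (l : ℂ) :
    Cone.planeHomeomorph (n := n) hk (Cone.polar k n (expPolar l)) =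
      Complex.exp ((k : ℂ) / n * l) := by
  change Cone.toPlane hk (Cone.polar k n (expPolar l)) = _
  rw [Cone.toPlane_polar, coe_expPolar_fst, expPolar_snd, ← Real.exp_mul,
    Complex.ofReal_exp, ← Complex.exp_add]
  congr 1
  conv_rhs => rw [← Complex.re_add_im l]
  push_cast
  ring

/-- A cone point read in the plane: the conformal homeomorphism from the cone to the plane turns
the cone into a disc with the metric for which, in the coordinate `w = exp (k l / n)`, the
developing map is `exp l`. -/
lemma isConePoint_iff_exists_planeChart {X : Type*} [TopologicalSpace X] {k : ℕ} (hk : 0 < k)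
    {S : Set X} {A : Set (OpenPartialHomeomorph X ℂ)} {p : X} {n : ℕ} :
    IsConePoint k S A p n ↔ 0 < n ∧ ∃ u : OpenPartialHomeomorph X ℂ,
      p ∈ u.source ∧ u p = 0 ∧ u.source ∩ S ⊆ {p} ∧
      ∀ e ∈ A, ∀ l : ℂ, Complex.exp ((k : ℂ) / n * l) ∈ u.target →
        u.symm (Complex.exp ((k : ℂ) / n * l)) ∈ e.source →
        ∃ V ∈ 𝓝 l, ∀ y ∈ V, ∀ y' ∈ V,
          dist (e (u.symm (Complex.exp ((k : ℂ) / n * y))))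
            (e (u.symm (Complex.exp ((k : ℂ) / n * y')))) =
          dist (Complex.exp y) (Complex.exp y') := by
  unfold IsConePoint
  refine and_congr_right fun hn => ?_
  have : NeZero n := ⟨hn.ne'⟩
  set φ := Cone.planeHomeomorph (n := n) hk with hφ
  have hinv : ∀ l, φ.symm (Complex.exp ((k : ℂ) / n * l)) = Cone.polar k n (expPolar l) := by
    intro l
    rw [← Cone.planeHomeomorph_polar_expPolar hk, Homeomorph.symm_apply_apply]
  constructor
  · rintro ⟨h, hp, hp0, hS, hiso⟩
    refine ⟨h.transHomeomorph φ, hp, ?_, hS, ?_⟩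
    · simp [hp0, hφ, Cone.planeHomeomorph_apex]
    · intro e he l hl hle
      simp only [OpenPartialHomeomorph.transHomeomorph_target, mem_preimage, hinv,
        OpenPartialHomeomorph.transHomeomorph_symm_apply, Function.comp] at hl hle ⊢
      obtain ⟨V, hV, hd⟩ := hiso e he (expPolar l) (expPolar_fst_pos l) hl hle
      refine ⟨expPolar ⁻¹' V, continuous_expPolar.continuousAt hV, fun y hy y' hy' => ?_⟩
      rw [hd _ hy _ hy', planePolar_expPolar, planePolar_expPolar]
  · rintro ⟨u, hp, hp0, hS, hiso⟩
    have hpol : ∀ l, φ (Cone.polar k n (expPolar l)) = Complex.exp ((k : ℂ) / n * l) :=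
      Cone.planeHomeomorph_polar_expPolar hk
    refine ⟨u.transHomeomorph φ.symm, hp, ?_, hS, ?_⟩
    · simp [hp0, hφ, ← Cone.planeHomeomorph_apex (n := n) hk]
    · intro e he x hx hl hle
      obtain ⟨l, rfl⟩ : ∃ l, expPolar l = x := ⟨_, expPolar_logPolar hx⟩
      simp only [OpenPartialHomeomorph.transHomeomorph_target, mem_preimage,
        OpenPartialHomeomorph.transHomeomorph_symm_apply, Function.comp,
        Homeomorph.symm_symm, hpol] at hl hle ⊢
      obtain ⟨V, hV, hd⟩ := hiso e he l hl hle
      have hll : logPolar (expPolar l) = l := by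
        rw [logPolar, coe_expPolar_fst, expPolar_snd, Real.log_exp, Complex.re_add_im]
      have hc := continuousAt_logPolar (expPolar_fst_pos l)
      rw [ContinuousAt, hll] at hc
      refine ⟨logPolar ⁻¹' V ∩ {x | 0 < x.1}, Filter.inter_mem (hc hV) ?_, ?_⟩
      · exact (isOpen_lt continuous_const continuous_fst).mem_nhds (expPolar_fst_pos l)
      · rintro y ⟨hy, hy0⟩ y' ⟨hy', hy0'⟩
        have := hd _ hy _ hy'
        rw [← hpol, ← hpol, ← planePolar_expPolar, ← planePolar_expPolar, expPolar_logPolar hy0,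
          expPolar_logPolar hy0'] at this
        exact this

/-! ### Local isometries of the plane -/

lemma mul_self_add_of_norm_eq {a b : ℂ} (h : ‖a‖ = ‖b‖) :
    a.re * a.re + a.im * a.im = b.re * b.re + b.im * b.im := by
  rw [← Complex.normSq_apply, ← Complex.normSq_apply, Complex.normSq_eq_norm_sq,
    Complex.normSq_eq_norm_sq, h]

/-- A complex number is determined by its distances to `0`, `δ` and `δ i`; the sign `s` allows for
a reflection in the real axis. -/
lemma re_eq_and_im_eq_of_norm_eq {δ : ℝ} (hδ : 0 < δ) {p q s : ℂ} (hs : s = 1 ∨ s = -1)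
    (h0 : ‖q‖ = ‖p‖) (h1 : ‖q - δ‖ = ‖p - δ‖)
    (h2 : ‖q - s * (δ * Complex.I)‖ = ‖p - δ * Complex.I‖) :
    q.re = p.re ∧ (q.im : ℂ) = s * p.im := by
  have e0 := mul_self_add_of_norm_eq h0
  have e1 := mul_self_add_of_norm_eq h1
  have e2 := mul_self_add_of_norm_eq h2
  simp at e1
  have hre : q.re = p.re := by
    have : δ * q.re = δ * p.re := by nlinarith
    exact mul_left_cancel₀ hδ.ne' this
  refine ⟨hre, ?_⟩
  rcases hs with rfl | rfl
  · simp at e2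
    have : δ * q.im = δ * p.im := by nlinarith
    rw [mul_left_cancel₀ hδ.ne' this, one_mul]
  · simp at e2
    have : δ * q.im = δ * (-p.im) := by nlinarith
    rw [mul_left_cancel₀ hδ.ne' this]
    push_cast; ring

/-- If `E` and `P` induce the same distance on `V`, and `P` is open at a point of `V`, then `E` is
on `V` the composition of `P` with a motion of the plane. -/
lemma exists_motion_of_dist_eq {E P : ℂ → ℂ} {V : Set ℂ} {l : ℂ} (hl : l ∈ V)
    (hP : P '' V ∈ 𝓝 (P l))
    (hd : ∀ y ∈ V, ∀ y' ∈ V, dist (E y) (E y') = dist (P y) (P y')) :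
    ∃ a b : ℂ, ‖a‖ = 1 ∧ ((∀ y ∈ V, E y = a * P y + b) ∨
      (∀ y ∈ V, E y = a * (starRingEnd ℂ) (P y) + b)) := by
  obtain ⟨ε, hε, hball⟩ := Metric.mem_nhds_iff.1 hP
  obtain ⟨δ, hδ, hδε⟩ : ∃ δ : ℝ, 0 < δ ∧ δ < ε := exists_between hε
  have hδ' : (δ : ℂ) ≠ 0 := by exact_mod_cast hδ.ne'
  obtain ⟨y1, hy1, hP1⟩ : P l + δ ∈ P '' V := hball (by simpa [abs_of_pos hδ] using hδε)
  obtain ⟨y2, hy2, hP2⟩ : P l + δ * Complex.I ∈ P '' V :=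
    hball (by simpa [abs_of_pos hδ] using hδε)
  -- The rotation part, normalised so that `E - E l` agrees with `a * (P - P l)` at `y1`.
  set a : ℂ := (E y1 - E l) / δ with ha
  have haδ : E y1 - E l = a * δ := by rw [ha]; field_simp
  have hna : ‖a‖ = 1 := by
    have := hd y1 hy1 l hl
    rw [dist_eq_norm, dist_eq_norm, hP1, haδ, norm_mul, add_sub_cancel_left] at this
    have h2 : ‖(δ : ℂ)‖ ≠ 0 := norm_ne_zero_iff.2 hδ'
    exact mul_right_cancel₀ h2 (by rw [this, one_mul])
  have ha0 : a ≠ 0 := by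
    intro h; rw [h, norm_zero] at hna; exact zero_ne_one hna
  have hdist : ∀ y ∈ V, ∀ y' ∈ V,
      ‖(E y - E l) / a - (E y' - E l) / a‖ = ‖(P y - P l) - (P y' - P l)‖ := by
    intro y hy y' hy'
    have := hd y hy y' hy'
    rw [dist_eq_norm, dist_eq_norm] at this
    rw [← sub_div, norm_div, hna, div_one, sub_sub_sub_cancel_right, this, sub_sub_sub_cancel_right]
  have hl0 : ∀ y ∈ V, ‖(E y - E l) / a‖ = ‖P y - P l‖ := by
    intro y hy
    simpa using hdist y hy l hl
  have hq1 : ∀ y ∈ V, ‖(E y - E l) / a - δ‖ = ‖(P y - P l) - δ‖ := by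
    intro y hy
    have := hdist y hy y1 hy1
    rwa [haδ, mul_div_cancel_left₀ _ ha0, hP1, add_sub_cancel_left] at this
  have hq2 : ∀ y ∈ V, ‖(E y - E l) / a - (E y2 - E l) / a‖ = ‖(P y - P l) - δ * Complex.I‖ := by
    intro y hy
    have := hdist y hy y2 hy2
    rwa [hP2, add_sub_cancel_left] at this
  -- The images of `0`, `δ`, `δ i` span a right isosceles triangle; its orientation is `s`.
  obtain ⟨s, hs, hs2⟩ : ∃ s : ℂ, (s = 1 ∨ s = -1) ∧ (E y2 - E l) / a = s * (δ * Complex.I) := by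
    have e0 := hl0 y2 hy2
    have e1 := hq1 y2 hy2
    rw [hP2, add_sub_cancel_left] at e0 e1
    set q := (E y2 - E l) / a
    have f0 := mul_self_add_of_norm_eq e0
    have f1 := mul_self_add_of_norm_eq e1
    simp at f0 f1
    have hre : q.re = 0 := by
      have : δ * q.re = 0 := by nlinarith
      exact (mul_eq_zero.1 this).resolve_left hδ.ne'
    rw [hre] at f0
    have him : q.im = δ ∨ q.im = -δ := mul_self_eq_mul_self_iff.1 (by linarith)
    rcases him with h | h
    · exact ⟨1, Or.inl rfl, Complex.ext (by simp [hre]) (by simp [h])⟩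
    · exact ⟨-1, Or.inr rfl, Complex.ext (by simp [hre]) (by simp [h])⟩
  have main : ∀ y ∈ V, E y - E l = a * ((P y - P l).re + s * (P y - P l).im * Complex.I) := by
    intro y hy
    obtain ⟨h1, h2⟩ := re_eq_and_im_eq_of_norm_eq hδ hs (hl0 y hy) (hq1 y hy) (by
      rw [← hs2]; exact hq2 y hy)
    rw [← h1, ← h2, Complex.re_add_im]
    field_simp
  rcases hs with rfl | rfl
  · refine ⟨a, E l - a * P l, hna, Or.inl fun y hy => ?_⟩
    have := main y hy
    rw [one_mul, Complex.re_add_im] at this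
    linear_combination this
  · refine ⟨a, E l - a * (starRingEnd ℂ) (P l), hna, Or.inr fun y hy => ?_⟩
    have := main y hy
    have hc : (starRingEnd ℂ) (P y - P l) =
        (P y - P l).re + -1 * (P y - P l).im * Complex.I := by
      apply Complex.ext
      · simp
      · simp
        ring
    rw [← hc, map_sub] at this
    linear_combination this

lemma not_affine_and_conj_affine {a b a' b' : ℂ} (ha : a ≠ 0) {P : ℂ → ℂ} {l : ℂ}
    (hP : ∀ V ∈ 𝓝 l, P '' V ∈ 𝓝 (P l))
    (h : ∀ᶠ y in 𝓝 l, a * P y + b = a' * (starRingEnd ℂ) (P y) + b') : False := by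
  obtain ⟨ε, hε, hball⟩ := Metric.mem_nhds_iff.1 (hP _ h)
  obtain ⟨δ, hδ, hδε⟩ : ∃ δ : ℝ, 0 < δ ∧ δ < ε := exists_between hε
  have hδ' : (δ : ℂ) ≠ 0 := by exact_mod_cast hδ.ne'
  obtain ⟨y1, hy1, hP1⟩ := hball (show P l + δ ∈ _ by simpa [abs_of_pos hδ] using hδε)
  obtain ⟨y2, hy2, hP2⟩ := hball (show P l + δ * Complex.I ∈ _ by
    simpa [abs_of_pos hδ] using hδε)
  have h0 := h.self_of_nhds
  simp only [mem_ofPred_eq, hP1, hP2, map_add, map_mul, Complex.conj_ofReal,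
    Complex.conj_I] at hy1 hy2
  have e1 : a * δ = a' * δ := by linear_combination hy1 - h0
  have e2 : a * (δ * Complex.I) = - (a' * (δ * Complex.I)) := by linear_combination hy2 - h0
  have e3 : a = a' := mul_right_cancel₀ hδ' e1
  have e4 : a = -a' := mul_right_cancel₀ (mul_ne_zero hδ' Complex.I_ne_zero) (by
    rw [e2]; ring)
  exact ha (by linear_combination (e3 + e4) / 2)

lemma image_exp_mem_nhds {V : Set ℂ} {l : ℂ} (hV : V ∈ 𝓝 l) :
    Complex.exp '' V ∈ 𝓝 (Complex.exp l) := by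
  have : HasStrictDerivAt Complex.exp (Complex.exp l) l := Complex.hasStrictDerivAt_exp l
  rw [← this.map_nhds_eq (Complex.exp_ne_zero l)]
  exact Filter.image_mem_map hV

/-- A locally constant labelling of the points of a non-empty preconnected set is constant. -/
lemma IsPreconnected.exists_forall_of_isOpen {α ι : Type*} [TopologicalSpace α] {s : Set α}
    (hs : IsPreconnected s) (hne : s.Nonempty) (P : ι → α → Prop)
    (hopen : ∀ i, IsOpen {x | x ∈ s ∧ P i x}) (hcov : ∀ x ∈ s, ∃ i, P i x)
    (hdisj : ∀ x ∈ s, ∀ i j, P i x → P j x → i = j) : ∃ i, ∀ x ∈ s, P i x := by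
  obtain ⟨x0, hx0⟩ := hne
  obtain ⟨i, hi⟩ := hcov x0 hx0
  refine ⟨i, fun x hx => ?_⟩
  have := hs.subset_left_of_subset_union (u := {x | x ∈ s ∧ P i x})
    (v := ⋃ j ∈ {j | j ≠ i}, {x | x ∈ s ∧ P j x}) (hopen i)
    (isOpen_biUnion fun j _ => hopen j) ?_ ?_ ⟨x0, hx0, hx0, hi⟩
  · exact (this hx).2
  · rw [Set.disjoint_left]
    rintro y ⟨hy, hyi⟩ hy'
    simp only [mem_ofPred_eq, mem_iUnion] at hy'
    obtain ⟨j, hj, -, hyj⟩ := hy'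
    exact hj (hdisj y hy j i hyj hyi)
  · intro y hy
    obtain ⟨j, hj⟩ := hcov y hy
    by_cases hji : j = i
    · subst hji; exact Or.inl ⟨hy, hj⟩
    · exact Or.inr (mem_biUnion (show j ∈ {j | j ≠ i} from hji) ⟨hy, hj⟩)

/-! ### The conformal coordinate at a cone point -/

lemma exp_two_pi_I_div_zpow_pow {k : ℕ} (hk : 0 < k) (r : ℤ) :
    (Complex.exp (2 * Real.pi * Complex.I / k) ^ r) ^ k = 1 := by
  have hk' : (k : ℂ) ≠ 0 := by exact_mod_cast hk.ne'
  rw [← zpow_natCast, ← zpow_mul, mul_comm r, zpow_mul, zpow_natCast, ← Complex.exp_nat_mul,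
    mul_div_cancel₀ _ hk', Complex.exp_two_pi_mul_I, one_zpow]

/-- The identity or the complex conjugation: up to a motion preserving orientation, the two
isometries of the plane. -/
noncomputable def orient (σ : Bool) (z : ℂ) : ℂ := if σ then z else (starRingEnd ℂ) z

/-- The function `E` is near `l` the composition of `exp` with the motion of linear part
`a * orient σ`. -/
def IsDevelopment (E : ℂ → ℂ) (σ : Bool) (a l : ℂ) : Prop :=
  a ≠ 0 ∧ ∃ b : ℂ, ∀ᶠ y in 𝓝 l, E y = a * orient σ (Complex.exp y) + b

lemma IsDevelopment.eventually {E : ℂ → ℂ} {σ : Bool} {a l : ℂ} (h : IsDevelopment E σ a l) :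
    ∀ᶠ y in 𝓝 l, IsDevelopment E σ a y := by
  obtain ⟨ha, b, hb⟩ := h
  filter_upwards [hb.eventually_nhds] with y hy
  exact ⟨ha, b, hy⟩

lemma IsDevelopment.unique {E : ℂ → ℂ} {σ τ : Bool} {a a' l : ℂ} (h : IsDevelopment E σ a l)
    (h' : IsDevelopment E τ a' l) : σ = τ ∧ a = a' := by
  obtain ⟨ha, b, hb⟩ := h
  obtain ⟨ha', b', hb'⟩ := h'
  have heq : ∀ᶠ y in 𝓝 l,
      a * orient σ (Complex.exp y) + b = a' * orient τ (Complex.exp y) + b' := by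
    filter_upwards [hb, hb'] with y h1 h2
    rw [← h1, h2]
  have key : ∀ {a a' b b' : ℂ}, (∀ᶠ y in 𝓝 l, a * Complex.exp y + b = a' * Complex.exp y + b') →
      a = a' := by
    intro a a' b b' h
    by_contra hne
    refine not_affine_and_conj_affine (a := a - a') (b := b) (a' := 0) (b' := b')
      (sub_ne_zero.2 hne) (P := Complex.exp) (l := l) (fun V hV => image_exp_mem_nhds hV) ?_
    filter_upwards [h] with y hy
    linear_combination hy
  cases σ <;> cases τ
  · refine ⟨rfl, ?_⟩
    simp only [orient, Bool.false_eq_true, if_false] at heq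
    have := key (a := (starRingEnd ℂ) a) (a' := (starRingEnd ℂ) a') (b := (starRingEnd ℂ) b)
      (b' := (starRingEnd ℂ) b') (by
        filter_upwards [heq] with y hy
        simpa using congrArg (starRingEnd ℂ) hy)
    exact (starRingEnd ℂ).injective this
  · simp only [orient, Bool.false_eq_true, if_false, if_true] at heq
    exact (not_affine_and_conj_affine ha' (fun V hV => image_exp_mem_nhds hV)
      (heq.mono fun y hy => hy.symm)).elim
  · simp only [orient, Bool.false_eq_true, if_false, if_true] at heq
    exact (not_affine_and_conj_affine ha (fun V hV => image_exp_mem_nhds hV) heq).elim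
  · refine ⟨rfl, ?_⟩
    simp only [orient, if_true] at heq
    exact key heq

section

variable {X : Type*} [TopologicalSpace X]

lemma KTranslationTransition.eventually_eq {k : ℕ} {e e' : OpenPartialHomeomorph X ℂ}
    (h : KTranslationTransition k e e') {x : X} (hx : x ∈ e.source) (hx' : x ∈ e'.source) :
    ∃ (r : ℤ) (c : ℂ), ∀ᶠ y in 𝓝 x,
      e' y = Complex.exp (2 * Real.pi * Complex.I / k) ^ r * e y + c := by
  obtain ⟨r, c, hrc⟩ := h (e x) (by simp [hx, hx'])
  refine ⟨r, c, ?_⟩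
  filter_upwards [(e.continuousAt hx).eventually hrc, e.open_source.mem_nhds hx] with y hy hys
  rwa [e.left_inv hys] at hy

/-- Changing the translation chart multiplies the linear part of the development by a `k`-th root
of unity. -/
lemma IsDevelopment.of_transition {k : ℕ} (hk : 0 < k) {e e' : OpenPartialHomeomorph X ℂ}
    (h : KTranslationTransition k e e') {q : ℂ → X} {l : ℂ} (hq : ContinuousAt q l)
    (hx : q l ∈ e.source) (hx' : q l ∈ e'.source) {σ : Bool} {a : ℂ}
    (hd : IsDevelopment (fun y => e (q y)) σ a l) :
    ∃ a', a' ^ k = a ^ k ∧ IsDevelopment (fun y => e' (q y)) σ a' l := by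
  obtain ⟨r, c, hrc⟩ := h.eventually_eq hx hx'
  obtain ⟨ha, b, hb⟩ := hd
  refine ⟨Complex.exp (2 * Real.pi * Complex.I / k) ^ r * a, ?_, ?_,
    Complex.exp (2 * Real.pi * Complex.I / k) ^ r * b + c, ?_⟩
  · rw [mul_pow, exp_two_pi_I_div_zpow_pow hk, one_mul]
  · exact mul_ne_zero (zpow_ne_zero _ (Complex.exp_ne_zero _)) ha
  · filter_upwards [hb, hq.eventually hrc] with y h1 h2
    rw [h2, h1]; ring

/-- Around a cone point the translation charts are developed with a constant orientation and with
linear parts whose `k`-th power is constant, because the logarithmic coordinate `l` runs through a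
half plane, which is connected. -/
lemma exists_forall_isDevelopment {k n : ℕ} (hk : 0 < k) (hn : 0 < n) {S : Set X}
    {A : Set (OpenPartialHomeomorph X ℂ)} (hA : IsMaximalAtlas Sᶜ (KTranslationTransition k) A)
    {p : X} (u : OpenPartialHomeomorph X ℂ) (hp : p ∈ u.source) (hp0 : u p = 0)
    (hS : u.source ∩ S ⊆ {p})
    (hiso : ∀ e ∈ A, ∀ l : ℂ, Complex.exp ((k : ℂ) / n * l) ∈ u.target →
        u.symm (Complex.exp ((k : ℂ) / n * l)) ∈ e.source →
        ∃ V ∈ 𝓝 l, ∀ y ∈ V, ∀ y' ∈ V,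
          dist (e (u.symm (Complex.exp ((k : ℂ) / n * y))))
            (e (u.symm (Complex.exp ((k : ℂ) / n * y')))) =
          dist (Complex.exp y) (Complex.exp y')) :
    ∃ ρ > 0, Metric.ball 0 ρ ⊆ u.target ∧ ∃ (σ : Bool) (c : ℂ), c ≠ 0 ∧
      ∀ l : ℂ, Complex.exp ((k : ℂ) / n * l) ∈ Metric.ball (0 : ℂ) ρ →
        ∀ e ∈ A, u.symm (Complex.exp ((k : ℂ) / n * l)) ∈ e.source →
          ∃ a, a ^ k = c ∧
            IsDevelopment (fun y => e (u.symm (Complex.exp ((k : ℂ) / n * y)))) σ a l := by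
  obtain ⟨ρ, hρ, hball⟩ := Metric.isOpen_iff.1 u.open_target 0 (hp0 ▸ u.map_source hp)
  refine ⟨ρ, hρ, hball, ?_⟩
  have hα : 0 < (k : ℝ) / n := by positivity
  set q : ℂ → X := fun l => u.symm (Complex.exp ((k : ℂ) / n * l)) with hq
  set s : Set ℂ := {l | Complex.exp ((k : ℂ) / n * l) ∈ Metric.ball (0 : ℂ) ρ} with hs
  have hsopen : IsOpen s := Metric.isOpen_ball.preimage (by fun_prop)
  have hs_eq : s = {l | l.re < Real.log ρ / ((k : ℝ) / n)} := by
    ext l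
    have h1 : ((k : ℂ) / n * l).re = (k : ℝ) / n * l.re := by
      have : (k : ℂ) / n = (((k : ℝ) / n : ℝ) : ℂ) := by push_cast; rfl
      rw [this, Complex.re_ofReal_mul]
    simp only [hs, mem_ofPred_eq, mem_ball_zero_iff, Complex.norm_exp, h1]
    rw [lt_div_iff₀ hα, Real.lt_log_iff_exp_lt hρ, mul_comm]
  have hconn : IsPreconnected s := by
    rw [hs_eq]; exact (convex_halfSpace_re_lt _).isPreconnected
  have hne : s.Nonempty := by
    rw [hs_eq]
    exact ⟨((Real.log ρ / ((k : ℝ) / n) - 1 : ℝ) : ℂ), by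
      simp only [mem_ofPred_eq, Complex.ofReal_re]; linarith⟩
  have hqc : ∀ l ∈ s, ContinuousAt q l := fun l hl =>
    (u.continuousAt_symm (hball hl)).comp (f := fun l => Complex.exp ((k : ℂ) / n * l))
      (by fun_prop)
  -- The point `q l` is not the cone point because `exp` has no zeros.
  have hcov : ∀ l ∈ s, ∃ e ∈ A, q l ∈ e.source := by
    intro l hl
    refine hA.cover _ fun hmem => Complex.exp_ne_zero ((k : ℂ) / n * l) ?_
    have : q l = p := hS ⟨u.map_target (hball hl), hmem⟩
    rw [← u.right_inv (hball hl), ← hp0, ← this]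
  -- The labels `(σ, a ^ k)` do not depend on the translation chart and are locally constant.
  have hlabel : ∃ i : Bool × ℂ, ∀ l ∈ s, ∃ e ∈ A, q l ∈ e.source ∧ ∃ a, a ^ k = i.2 ∧
      IsDevelopment (fun y => e (q y)) i.1 a l := by
    refine hconn.exists_forall_of_isOpen hne (fun (i : Bool × ℂ) l => ∃ e ∈ A, q l ∈ e.source ∧
      ∃ a, a ^ k = i.2 ∧ IsDevelopment (fun y => e (q y)) i.1 a l) ?_ ?_ ?_
    · intro i
      rw [isOpen_iff_mem_nhds]
      rintro l ⟨hl, e, he, hle, a, ha, hd⟩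
      filter_upwards [hsopen.mem_nhds hl, (hqc l hl).preimage_mem_nhds (e.open_source.mem_nhds hle),
        hd.eventually] with y h1 h2 h3
      exact ⟨h1, e, he, h2, a, ha, h3⟩
    · intro l hl
      obtain ⟨e, he, hle⟩ := hcov l hl
      obtain ⟨V, hV, hd⟩ := hiso e he l (hball hl) hle
      obtain ⟨a, b, ha, hab⟩ := exists_motion_of_dist_eq (E := fun y => e (q y)) (P := Complex.exp)
        (mem_of_mem_nhds hV) (image_exp_mem_nhds hV) hd
      have ha0 : a ≠ 0 := by
        rintro rfl; simp at ha
      rcases hab with hab | hab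
      · exact ⟨(true, a ^ k), e, he, hle, a, rfl, ha0, b, by
          filter_upwards [hV] with y hy; simpa [orient] using hab y hy⟩
      · exact ⟨(false, a ^ k), e, he, hle, a, rfl, ha0, b, by
          filter_upwards [hV] with y hy; simpa [orient] using hab y hy⟩
    · rintro l hl ⟨σ, c⟩ ⟨τ, d⟩ ⟨e, he, hle, a, ha, hda⟩ ⟨e', he', hle', a', ha', hda'⟩
      obtain ⟨a'', h1, h2⟩ := hda.of_transition hk (hA.compatible e he e' he') (hqc l hl) hle hle'
      obtain ⟨h3, h4⟩ := h2.unique hda'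
      ext1
      · exact h3
      · rw [← ha, ← ha', ← h4, h1]
  obtain ⟨⟨σ, c⟩, hall⟩ := hlabel
  refine ⟨σ, c, ?_, fun l hl e he hle => ?_⟩
  · obtain ⟨l, hl⟩ := hne
    obtain ⟨e, -, -, a, rfl, ha, -⟩ := hall l hl
    exact pow_ne_zero _ ha
  · obtain ⟨e', he', hle', a, rfl, ha⟩ := hall l hl
    obtain ⟨a', h1, h2⟩ := ha.of_transition hk (hA.compatible e' he' e he) (hqc l hl) hle' hle
    exact ⟨a', h1, h2⟩

/-- The function `f` whose lift to the logarithmic coordinate is `a * exp + b` is `a * z ^ (n / k)`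
up to a constant, hence its derivative. -/
lemma hasDerivAt_of_isDevelopment {k n : ℕ} (hk : 0 < k) (hn : 0 < n) {f : ℂ → ℂ} {a l : ℂ}
    (h : IsDevelopment (fun y => f (Complex.exp ((k : ℂ) / n * y))) true a l) :
    HasDerivAt f (a * Complex.exp l / ((k : ℂ) / n * Complex.exp ((k : ℂ) / n * l)))
      (Complex.exp ((k : ℂ) / n * l)) := by
  have hα : (k : ℂ) / n ≠ 0 := by
    have h1 : (k : ℂ) ≠ 0 := by exact_mod_cast hk.ne'
    have h2 : (n : ℂ) ≠ 0 := by exact_mod_cast hn.ne'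
    exact div_ne_zero h1 h2
  set α := (k : ℂ) / n
  set w := Complex.exp (α * l) with hw
  have hw0 : w ≠ 0 := Complex.exp_ne_zero _
  obtain ⟨-, b, hb⟩ := h
  -- The local inverse of `l ↦ exp (α l)`.
  have hL : HasDerivAt (fun z => l + Complex.log (z / w) / α) (1 / (α * w)) w := by
    have h1 : HasDerivAt (fun z => Complex.log (z / w)) (1 / w / (w / w)) w :=
      ((hasDerivAt_id w).div_const w).clog (by
        rw [id, div_self hw0]; exact Complex.one_mem_slitPlane)
    have h2 : 1 / (α * w) = 1 / w / (w / w) / α := by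
      rw [div_self hw0]
      field_simp
    rw [h2]
    exact (h1.div_const α).const_add l
  have hLw : l + Complex.log (w / w) / α = l := by simp [div_self hw0]
  have hev : ∀ᶠ z in 𝓝 w, f z = a * Complex.exp (l + Complex.log (z / w) / α) + b := by
    have hc := hL.continuousAt
    rw [ContinuousAt, hLw] at hc
    filter_upwards [hc.eventually hb, isOpen_ne.mem_nhds hw0] with z hz hz0
    have h2 : Complex.exp (α * (l + Complex.log (z / w) / α)) = z := by
      rw [mul_add, mul_div_cancel₀ _ hα, Complex.exp_add, Complex.exp_log (div_ne_zero hz0 hw0),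
        ← hw]
      field_simp
    rw [h2] at hz
    simpa [orient] using hz
  refine HasDerivAt.congr_of_eventuallyEq ?_ hev
  convert (hL.cexp.const_mul a).add_const b using 1
  rw [hLw]
  ring

lemma pow_deriv_of_isDevelopment {k n : ℕ} (hk : 0 < k) (hn : 0 < n) {f : ℂ → ℂ} {a l : ℂ}
    (h : IsDevelopment (fun y => f (Complex.exp ((k : ℂ) / n * y))) true a l) :
    deriv f (Complex.exp ((k : ℂ) / n * l)) ^ k =
      a ^ k / ((k : ℂ) / n) ^ k * Complex.exp ((k : ℂ) / n * l) ^ ((n : ℤ) - k) := by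
  rw [(hasDerivAt_of_isDevelopment hk hn h).deriv, div_pow, mul_pow, mul_pow,
    zpow_sub₀ (Complex.exp_ne_zero _), zpow_natCast, zpow_natCast]
  have h1 : Complex.exp l ^ k = Complex.exp ((k : ℂ) / n * l) ^ n := by
    rw [← Complex.exp_nat_mul, ← Complex.exp_nat_mul]
    have h2 : (n : ℂ) ≠ 0 := by exact_mod_cast hn.ne'
    congr 1
    field_simp
  rw [h1]
  ring

/-- The chart `u` is conformal at the cone point `p` of angle `2 π n / k`: it is centred at `p`,
and in the coordinate `u` the translation charts away from `p` are holomorphic with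
`(dz) ^ k = c * u ^ (n - k) * (du) ^ k`. -/
structure IsConeChart (k n : ℕ) (S : Set X) (A : Set (OpenPartialHomeomorph X ℂ)) (p : X)
    (c : ℂ) (u : OpenPartialHomeomorph X ℂ) : Prop where
  mem_source : p ∈ u.source
  map_eq_zero : u p = 0
  source_inter_subset : u.source ∩ S ⊆ {p}
  ne_zero : c ≠ 0
  differentiableAt : ∀ e ∈ A, ∀ z ∈ u.target, z ≠ 0 → u.symm z ∈ e.source →
    DifferentiableAt ℂ (fun w => e (u.symm w)) z
  pow_deriv : ∀ e ∈ A, ∀ z ∈ u.target, z ≠ 0 → u.symm z ∈ e.source →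
    deriv (fun w => e (u.symm w)) z ^ k = c * z ^ ((n : ℤ) - k)

lemma isConeChart_of_isDevelopment {k n : ℕ} (hk : 0 < k) (hn : 0 < n) {S : Set X}
    {A : Set (OpenPartialHomeomorph X ℂ)}
    {p : X} (u : OpenPartialHomeomorph X ℂ) (hp : p ∈ u.source) (hp0 : u p = 0)
    (hS : u.source ∩ S ⊆ {p}) {ρ : ℝ} (hρ : 0 < ρ)
    {c : ℂ} (hc : c ≠ 0)
    (h : ∀ l : ℂ, Complex.exp ((k : ℂ) / n * l) ∈ Metric.ball (0 : ℂ) ρ →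
        ∀ e ∈ A, u.symm (Complex.exp ((k : ℂ) / n * l)) ∈ e.source →
          ∃ a, a ^ k = c ∧
            IsDevelopment (fun y => e (u.symm (Complex.exp ((k : ℂ) / n * y)))) true a l) :
    ∃ c v, IsConeChart k n S A p c v := by
  have h1 : (k : ℂ) ≠ 0 := by exact_mod_cast hk.ne'
  have h2 : (n : ℂ) ≠ 0 := by exact_mod_cast hn.ne'
  have hα : (k : ℂ) / n ≠ 0 := div_ne_zero h1 h2
  have hopen : IsOpen (u.source ∩ u ⁻¹' Metric.ball 0 ρ) :=
    u.isOpen_inter_preimage Metric.isOpen_ball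
  have hlog : ∀ z : ℂ, z ≠ 0 → ∃ l, Complex.exp ((k : ℂ) / n * l) = z := fun z hz =>
    ⟨Complex.log z / ((k : ℂ) / n), by rw [mul_div_cancel₀ _ hα, Complex.exp_log hz]⟩
  have htarget : ∀ z ∈ (u.restrOpen _ hopen).target, z ∈ Metric.ball (0 : ℂ) ρ := by
    rintro z ⟨hz, hz'⟩
    have := hz'.2
    rwa [mem_preimage, u.right_inv hz] at this
  refine ⟨c / ((k : ℂ) / n) ^ k, u.restrOpen _ hopen, ⟨hp, hp, by simpa [hp0] using hρ⟩, hp0,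
    fun x hx => hS ⟨hx.1.1, hx.2⟩, div_ne_zero hc (pow_ne_zero _ hα), ?_, ?_⟩
  · intro e he z hz hz0 hze
    obtain ⟨l, rfl⟩ := hlog z hz0
    obtain ⟨a, -, ha⟩ := h l (htarget _ hz) e he hze
    exact (hasDerivAt_of_isDevelopment (f := fun w => e (u.symm w)) hk hn ha).differentiableAt
  · intro e he z hz hz0 hze
    obtain ⟨l, rfl⟩ := hlog z hz0
    obtain ⟨a, rfl, ha⟩ := h l (htarget _ hz) e he hze
    exact pow_deriv_of_isDevelopment (f := fun w => e (u.symm w)) hk hn ha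

/-- Every cone point has a conformal coordinate; if the given isometry to the cone reverses the
orientation, it has to be composed with a reflection. -/
lemma IsConePoint.exists_isConeChart {k n : ℕ} (hk : 0 < k) {S : Set X}
    {A : Set (OpenPartialHomeomorph X ℂ)} (hA : IsMaximalAtlas Sᶜ (KTranslationTransition k) A)
    {p : X} (h : IsConePoint k S A p n) : ∃ c u, IsConeChart k n S A p c u := by
  obtain ⟨hn, u, hp, hp0, hS, hiso⟩ := (isConePoint_iff_exists_planeChart hk).1 h
  obtain ⟨ρ, hρ, hball, σ, c, hc, hdev⟩ := exists_forall_isDevelopment hk hn hA u hp hp0 hS hiso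
  cases σ with
  | true => exact isConeChart_of_isDevelopment hk hn u hp hp0 hS hρ hc hdev
  | false =>
    have hconj : ∀ l : ℂ, (starRingEnd ℂ) (Complex.exp ((k : ℂ) / n * l)) =
        Complex.exp ((k : ℂ) / n * (starRingEnd ℂ) l) := by
      intro l
      rw [← Complex.exp_conj]
      simp
    refine isConeChart_of_isDevelopment hk hn (u.transHomeomorph Complex.conjCLE.toHomeomorph)
      hp (by simp [hp0]) hS hρ hc ?_
    intro l hl e he hle
    have hsymm : ∀ y, (u.transHomeomorph Complex.conjCLE.toHomeomorph).symm
        (Complex.exp ((k : ℂ) / n * y)) =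
        u.symm (Complex.exp ((k : ℂ) / n * (starRingEnd ℂ) y)) := by
      intro y
      rw [← hconj]
      rfl
    rw [hsymm] at hle
    obtain ⟨a, ha, ha0, b, hb⟩ := hdev ((starRingEnd ℂ) l) (by
      rw [← hconj]; simpa using hl) e he hle
    refine ⟨a, ha, ha0, b, ?_⟩
    filter_upwards [Complex.continuous_conj.continuousAt.eventually hb] with y hy
    rw [hsymm, hy]
    simp [orient, ← Complex.exp_conj]

end

/-! ### Normal forms of holomorphic functions -/

/-- Two functions whose derivatives have the same `k`-th power differ by a motion whose linear
part is a `k`-th root of unity. -/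
lemma exists_eq_mul_add_of_pow_deriv_eq {k : ℕ} (hk : 0 < k) {F P : ℂ → ℂ} {U : Set ℂ}
    (hU : IsOpen U) (hconn : IsConnected U) (hF : DifferentiableOn ℂ F U)
    (hP : DifferentiableOn ℂ P U) (hP0 : ∀ z ∈ U, deriv P z ≠ 0)
    (h : ∀ z ∈ U, deriv F z ^ k = deriv P z ^ k) :
    ∃ ω b : ℂ, ω ^ k = 1 ∧ ∀ z ∈ U, F z = ω * P z + b := by
  have hG : DifferentiableOn ℂ (fun z => deriv F z / deriv P z) U :=
    (hF.deriv hU).div (hP.deriv hU) hP0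
  have hGk : ∀ z ∈ U, (deriv F z / deriv P z) ^ k = 1 := by
    intro z hz
    rw [div_pow, h z hz, div_self (pow_ne_zero _ (hP0 z hz))]
  obtain ⟨ω, hω⟩ := hU.exists_is_const_of_deriv_eq_zero hconn.isPreconnected hG (by
    intro z hz
    have hd := (hG.differentiableAt (hU.mem_nhds hz)).hasDerivAt
    have h1 := hd.pow k
    have h2 : HasDerivAt (fun z => (deriv F z / deriv P z) ^ k) 0 z :=
      (hasDerivAt_const z (1 : ℂ)).congr_of_eventuallyEq
        (Filter.eventuallyEq_of_mem (hU.mem_nhds hz) hGk)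
    have h3 := h1.unique h2
    have hk0 : (k : ℂ) ≠ 0 := by exact_mod_cast hk.ne'
    have hne : deriv F z / deriv P z ≠ 0 := by
      intro h0
      have := hGk z hz
      rw [h0, zero_pow hk.ne'] at this
      exact zero_ne_one this
    exact (mul_eq_zero.1 h3).resolve_left (mul_ne_zero hk0 (pow_ne_zero _ hne)))
  obtain ⟨z0, hz0⟩ := hconn.nonempty
  obtain ⟨b, hb⟩ := hU.exists_is_const_of_deriv_eq_zero (f := fun z => F z - ω * P z)
    hconn.isPreconnected (hF.sub (hP.const_mul ω)) (by
      intro z hz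
      have h1 := (hF.differentiableAt (hU.mem_nhds hz)).hasDerivAt
      have h2 := (hP.differentiableAt (hU.mem_nhds hz)).hasDerivAt
      have h3 := (h1.sub (h2.const_mul ω)).deriv
      have h4 : deriv F z = ω * deriv P z := (div_eq_iff (hP0 z hz)).1 (hω z hz)
      rw [h4, sub_self] at h3
      exact h3)
  exact ⟨ω, b, by rw [← hω z0 hz0, hGk z0 hz0], fun z hz => by rw [← hb z hz]; ring⟩

lemma exists_analyticAt_exp_eq {g : ℂ → ℂ} {z₀ : ℂ} (hg : AnalyticAt ℂ g z₀) (h0 : g z₀ ≠ 0) :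
    ∃ L : ℂ → ℂ, AnalyticAt ℂ L z₀ ∧ ∀ᶠ z in 𝓝 z₀, Complex.exp (L z) = g z := by
  refine ⟨fun z => Complex.log (g z / g z₀) + Complex.log (g z₀), ?_, ?_⟩
  · refine AnalyticAt.add (AnalyticAt.clog (hg.div analyticAt_const h0) ?_) analyticAt_const
    rw [div_self h0]
    exact Complex.one_mem_slitPlane
  · filter_upwards [hg.continuousAt.eventually_ne h0] with z hz
    rw [Complex.exp_add, Complex.exp_log (div_ne_zero hz h0), Complex.exp_log h0,
      div_mul_cancel₀ _ h0]

/-- The equation `β H + (z - z₀) H' = φ` has an analytic solution, obtained by dividing the `j`-th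
Taylor coefficient of `φ` by `β + j`. -/
lemma exists_analyticAt_mul_add_mul_deriv_eq {φ : ℂ → ℂ} {z₀ : ℂ} (hφ : AnalyticAt ℂ φ z₀)
    {β : ℝ} (hβ : 0 < β) :
    ∃ H : ℂ → ℂ, AnalyticAt ℂ H z₀ ∧
      ∀ᶠ z in 𝓝 z₀, (β : ℂ) * H z + (z - z₀) * deriv H z = φ z := by
  obtain ⟨p, r, hp⟩ := hφ
  obtain ⟨R, hR0, hRr⟩ := ENNReal.lt_iff_exists_nnreal_btwn.1 hp.r_pos
  have hR0' : (0 : ℝ) < R := by exact_mod_cast hR0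
  have hsum := p.summable_norm_mul_pow (hRr.trans_le hp.r_le)
  set F : ℕ → ℂ → ℂ := fun j z => p.coeff j / (β + j) * (z - z₀) ^ j with hF
  have hβj : ∀ j : ℕ, β ≤ ‖(β : ℂ) + j‖ := by
    intro j
    have : (β : ℂ) + j = ((β + j : ℝ) : ℂ) := by push_cast; rfl
    rw [this, Complex.norm_real, Real.norm_of_nonneg (by positivity)]
    have : (0 : ℝ) ≤ j := by positivity
    linarith
  have hβj0 : ∀ j : ℕ, (β : ℂ) + j ≠ 0 := fun j h => by
    have := hβj j
    rw [h, norm_zero] at this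
    linarith
  have hdiff : ∀ j, Differentiable ℂ (F j) := fun j => by
    simp only [hF]; fun_prop
  have hle : ∀ (j : ℕ) (w : ℂ), w ∈ Metric.ball z₀ R → ‖F j w‖ ≤ ‖p j‖ * (R : ℝ) ^ j / β := by
    intro j w hw
    rw [Metric.mem_ball, dist_eq_norm] at hw
    simp only [hF]
    rw [norm_mul, norm_div, norm_pow, FormalMultilinearSeries.norm_apply_eq_norm_coef,
      div_mul_eq_mul_div]
    gcongr
    exact hβj j
  have hu : Summable fun j => ‖p j‖ * (R : ℝ) ^ j / β := hsum.div_const β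
  have hHd := Complex.differentiableOn_tsum_of_summable_norm hu
    (fun j => (hdiff j).differentiableOn) Metric.isOpen_ball hle
  refine ⟨fun z => ∑' j, F j z, hHd.analyticAt (Metric.ball_mem_nhds z₀ hR0'), ?_⟩
  filter_upwards [Metric.ball_mem_nhds z₀ hR0'] with z hz
  have h1 : HasSum (fun j => F j z) (∑' j, F j z) :=
    (Summable.of_norm_bounded hu fun j => hle j z hz).hasSum
  have h2 := Complex.hasSum_deriv_of_summable_norm hu
    (fun j => (hdiff j).differentiableOn) Metric.isOpen_ball hle hz
  have h3 : HasSum (fun j => (z - z₀) ^ j • p.coeff j) (φ z) := by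
    have := hp.hasSum_sub (y := z) (by
      rw [Metric.mem_ball, dist_eq_norm] at hz
      rw [Metric.mem_eball, edist_eq_enorm_sub]
      refine lt_trans ?_ hRr
      rw [enorm_eq_nnnorm]
      exact_mod_cast hz)
    simpa only [FormalMultilinearSeries.apply_eq_pow_smul_coeff] using this
  suffices hterm : ∀ j, (β : ℂ) * F j z + (z - z₀) * deriv (F j) z = (z - z₀) ^ j • p.coeff j from
    ((h1.mul_left (β : ℂ)).add (h2.mul_left (z - z₀))).unique (by simpa only [hterm] using h3)
  intro j
  have hd : deriv (F j) z = p.coeff j / (β + j) * (j * (z - z₀) ^ (j - 1)) := by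
    simp [hF]
  rw [hd, smul_eq_mul]
  have hj := hβj0 j
  have hpow : (z - z₀) * (j * (z - z₀) ^ (j - 1)) = j * (z - z₀) ^ j := by
    cases j with
    | zero => simp
    | succ i => rw [Nat.add_sub_cancel, pow_succ]; ring
  calc _ = p.coeff j / (β + j) * (β * (z - z₀) ^ j + (z - z₀) * (j * (z - z₀) ^ (j - 1))) := by
        simp only [hF]; ring
    _ = _ := by rw [hpow]; field_simp

/-- A meromorphic `k`-differential of order `m > -k` is `(n / k) ^ k * v ^ m * (dv) ^ k` in a
suitable local coordinate `v`, where `n = k + m`. -/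
lemma exists_normalForm_coordinate {k n : ℕ} (hk : 0 < k) (hn : 0 < n) {f : ℂ → ℂ} {z₀ : ℂ}
    (hf : MeromorphicAt f z₀) (hm : meromorphicOrderAt f z₀ = ((n : ℤ) - k : ℤ)) :
    ∃ v : ℂ → ℂ, AnalyticAt ℂ v z₀ ∧ v z₀ = 0 ∧ deriv v z₀ ≠ 0 ∧
      ∀ᶠ z in 𝓝[≠] z₀, f z = ((n : ℂ) / k) ^ k * v z ^ ((n : ℤ) - k) * deriv v z ^ k := by
  have hk0 : (k : ℂ) ≠ 0 := by exact_mod_cast hk.ne'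
  have hn0 : (n : ℂ) ≠ 0 := by exact_mod_cast hn.ne'
  obtain ⟨g, hg, hg0, hfg⟩ := (meromorphicOrderAt_eq_int_iff hf).1 hm
  obtain ⟨L, hL, hLg⟩ := exists_analyticAt_exp_eq hg hg0
  have hβ : (0 : ℝ) < (n : ℝ) / k := by positivity
  obtain ⟨H, hH, hHeq⟩ := exists_analyticAt_mul_add_mul_deriv_eq
    (φ := fun z => Complex.exp (L z / k)) (by fun_prop) hβ
  have hβc : (((n : ℝ) / k : ℝ) : ℂ) = (n : ℂ) / k := by push_cast; rfl
  rw [hβc] at hHeq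
  have hH0 : H z₀ ≠ 0 := by
    intro h0
    have := hHeq.self_of_nhds
    simp only [h0, mul_zero, sub_self, zero_mul, add_zero] at this
    exact Complex.exp_ne_zero _ this.symm
  obtain ⟨M, hM, hMH⟩ := exists_analyticAt_exp_eq hH hH0
  set β := (n : ℂ) / k with hβdef
  have hβ0 : β ≠ 0 := div_ne_zero hn0 hk0
  have hder : ∀ᶠ z in 𝓝 z₀, HasDerivAt (fun z => (z - z₀) * Complex.exp (M z / β))
      (Complex.exp (M z / β) * (1 + (z - z₀) * (deriv M z / β))) z := by
    filter_upwards [hM.eventually_analyticAt] with z hz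
    have h1 := (hz.differentiableAt.hasDerivAt.div_const β).cexp
    have h2 : Complex.exp (M z / β) * (1 + (z - z₀) * (deriv M z / β)) =
        1 * Complex.exp (M z / β) + (z - z₀) * (Complex.exp (M z / β) * (deriv M z / β)) := by
      ring
    rw [h2]
    exact ((hasDerivAt_id z).sub_const z₀).mul h1
  refine ⟨fun z => (z - z₀) * Complex.exp (M z / β), ?_, by simp, ?_, ?_⟩
  · have : AnalyticAt ℂ (fun z => M z / β) z₀ := hM.div analyticAt_const hβ0
    fun_prop
  · rw [hder.self_of_nhds.deriv]
    simp
  · have hH' : ∀ᶠ z in 𝓝 z₀, deriv H z = Complex.exp (M z) * deriv M z := by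
      filter_upwards [hMH.eventually_nhds, hM.eventually_analyticAt] with z hz hz'
      have : H =ᶠ[𝓝 z] fun z => Complex.exp (M z) := hz.mono fun y hy => hy.symm
      rw [this.deriv_eq]
      exact hz'.differentiableAt.hasDerivAt.cexp.deriv
    filter_upwards [hfg, nhdsWithin_le_nhds hder, nhdsWithin_le_nhds hH', nhdsWithin_le_nhds hMH,
      nhdsWithin_le_nhds hHeq, nhdsWithin_le_nhds hLg,
      self_mem_nhdsWithin] with z h1 h2 h3 h4 h5 h6 h7
    have hz0 : z - z₀ ≠ 0 := sub_ne_zero.2 h7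
    rw [h2.deriv, h1, smul_eq_mul, ← h6]
    rw [h3, ← h4] at h5
    -- The `k`-th power of the equation satisfied by `H = exp M`.
    have h8 : Complex.exp (L z) = (β * (1 + (z - z₀) * (deriv M z / β))) ^ k *
        Complex.exp (M z) ^ k := by
      rw [← mul_pow]
      have : β * (1 + (z - z₀) * (deriv M z / β)) * Complex.exp (M z) =
          Complex.exp (L z / k) := by
        rw [← h5]; field_simp
      rw [this, ← Complex.exp_nat_mul, mul_div_cancel₀ _ hk0]
    have h9 : Complex.exp (M z) ^ k = Complex.exp (M z / β) ^ n := by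
      rw [← Complex.exp_nat_mul, ← Complex.exp_nat_mul]
      congr 1
      rw [hβdef]; field_simp
    have h10 : Complex.exp (M z / β) ^ n =
        Complex.exp (M z / β) ^ ((n : ℤ) - k) * Complex.exp (M z / β) ^ k := by
      rw [← zpow_natCast _ k, ← zpow_add₀ (Complex.exp_ne_zero _), sub_add_cancel, zpow_natCast]
    rw [h8, h9, h10, mul_zpow, mul_pow, mul_pow]
    ring

/-- The inverse function theorem: an analytic function with non-zero derivative at `z₀` is
biholomorphic on a neighbourhood of `z₀` contained in any given one. -/
lemma AnalyticAt.exists_openPartialHomeomorph {v : ℂ → ℂ} {z₀ : ℂ} (hv : AnalyticAt ℂ v z₀)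
    (h0 : deriv v z₀ ≠ 0) {W : Set ℂ} (hW : W ∈ 𝓝 z₀) :
    ∃ ψ : OpenPartialHomeomorph ℂ ℂ, z₀ ∈ ψ.source ∧ ψ.source ⊆ W ∧ (∀ z, ψ z = v z) ∧
      (∀ z ∈ ψ.source, DifferentiableAt ℂ v z ∧ deriv v z ≠ 0) ∧
      ∀ w ∈ ψ.target, DifferentiableAt ℂ ψ.symm w := by
  have hs : HasStrictDerivAt v (deriv v z₀) z₀ := hv.hasStrictDerivAt
  set ψ₀ := (hs.hasStrictFDerivAt_equiv h0).toOpenPartialHomeomorph v with hψ₀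
  have hnhds : {z | AnalyticAt ℂ v z ∧ deriv v z ≠ 0} ∩ W ∈ 𝓝 z₀ :=
    Filter.inter_mem (hv.eventually_analyticAt.and
      (hv.deriv.continuousAt.eventually_ne h0)) hW
  obtain ⟨O, hOsub, hO, hzO⟩ := mem_nhds_iff.1 hnhds
  have hmem : z₀ ∈ ψ₀.source :=
    (hs.hasStrictFDerivAt_equiv h0).mem_toOpenPartialHomeomorph_source
  have hprop : ∀ z ∈ (ψ₀.restrOpen O hO).source, DifferentiableAt ℂ v z ∧ deriv v z ≠ 0 :=
    fun z hz => ⟨(hOsub hz.2).1.1.differentiableAt, (hOsub hz.2).1.2⟩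
  refine ⟨ψ₀.restrOpen O hO, ⟨hmem, hzO⟩, fun z hz => (hOsub hz.2).2, fun z => rfl, hprop, ?_⟩
  intro w hw
  have h1 := (ψ₀.restrOpen O hO).map_target hw
  obtain ⟨h2, h3⟩ := hprop _ h1
  exact ((ψ₀.restrOpen O hO).hasDerivAt_symm hw h3 h2.hasDerivAt).differentiableAt

section

variable {X : Type*} [TopologicalSpace X]

/-- A conformal chart with `(dz) ^ k = (n / k) ^ k * u ^ (n - k) * (du) ^ k` is an isometry to the
cone, because the `k`-th power of the derivative of the developing map in the logarithmic
coordinate is `exp ^ k`. -/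
lemma IsConeChart.isConePoint {k n : ℕ} (hk : 0 < k) (hn : 0 < n) {S : Set X}
    {A : Set (OpenPartialHomeomorph X ℂ)} {p : X} {u : OpenPartialHomeomorph X ℂ}
    (h : IsConeChart k n S A p (((n : ℂ) / k) ^ k) u) : IsConePoint k S A p n := by
  have hk0 : (k : ℂ) ≠ 0 := by exact_mod_cast hk.ne'
  have hn0 : (n : ℂ) ≠ 0 := by exact_mod_cast hn.ne'
  refine (isConePoint_iff_exists_planeChart hk).2
    ⟨hn, u, h.mem_source, h.map_eq_zero, h.source_inter_subset, ?_⟩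
  intro e he l hl hle
  set α := (k : ℂ) / n with hα
  have hopen : IsOpen {y : ℂ | Complex.exp (α * y) ∈ u.target ∧
      u.symm (Complex.exp (α * y)) ∈ e.source} :=
    (u.symm.isOpen_inter_preimage e.open_source).preimage
      (f := fun y : ℂ => Complex.exp (α * y)) (by fun_prop)
  obtain ⟨δ, hδ, hball⟩ := Metric.isOpen_iff.1 hopen l ⟨hl, hle⟩
  have hder : ∀ y ∈ Metric.ball l δ, HasDerivAt (fun y => e (u.symm (Complex.exp (α * y))))
      (deriv (fun w => e (u.symm w)) (Complex.exp (α * y)) * (Complex.exp (α * y) * α)) y := by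
    intro y hy
    obtain ⟨h1, h2⟩ := hball hy
    have h3 := (h.differentiableAt e he _ h1 (Complex.exp_ne_zero _) h2).hasDerivAt
    have h4 : HasDerivAt (fun y => Complex.exp (α * y)) (Complex.exp (α * y) * α) y := by
      simpa using ((hasDerivAt_id y).const_mul α).cexp
    exact h3.comp y h4
  obtain ⟨ω, b, hω, hb⟩ := exists_eq_mul_add_of_pow_deriv_eq hk (P := Complex.exp)
    Metric.isOpen_ball ((convex_ball l δ).isConnected ⟨l, Metric.mem_ball_self hδ⟩)
    (fun y hy => (hder y hy).differentiableAt.differentiableWithinAt)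
    (Complex.differentiable_exp.differentiableOn)
    (fun y _ => by rw [Complex.deriv_exp]; exact Complex.exp_ne_zero _) (by
      intro y hy
      obtain ⟨h1, h2⟩ := hball hy
      rw [(hder y hy).deriv, mul_pow, h.pow_deriv e he _ h1 (Complex.exp_ne_zero _) h2,
        Complex.deriv_exp, mul_pow, zpow_sub₀ (Complex.exp_ne_zero _), zpow_natCast, zpow_natCast]
      have h5 : Complex.exp (α * y) ^ n = Complex.exp y ^ k := by
        rw [← Complex.exp_nat_mul, ← Complex.exp_nat_mul]
        congr 1
        rw [hα]; field_simp
      have h6 : ((n : ℂ) / k) ^ k * α ^ k = 1 := by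
        have h61 : (n : ℂ) / k * (k / n) = 1 := by field_simp
        rw [← mul_pow, hα, h61, one_pow]
      have h7 : Complex.exp (α * y) ^ k ≠ 0 := pow_ne_zero _ (Complex.exp_ne_zero _)
      rw [h5]
      calc _ = (((n : ℂ) / k) ^ k * α ^ k) * Complex.exp y ^ k *
            (Complex.exp (α * y) ^ k / Complex.exp (α * y) ^ k) := by ring
        _ = _ := by rw [h6, div_self h7, one_mul, mul_one])
  refine ⟨Metric.ball l δ, Metric.ball_mem_nhds l hδ, fun y hy y' hy' => ?_⟩
  have hω1 : ‖ω‖ = 1 := Complex.norm_eq_one_of_pow_eq_one hω hk.ne'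
  rw [hb y hy, hb y' hy', dist_add_right, dist_eq_norm, dist_eq_norm, ← mul_sub, norm_mul, hω1,
    one_mul]

end

/-! ### Holomorphic changes of charts -/

section

variable {X : Type*} [TopologicalSpace X]

/-- The change of charts from `e` to `e'` is differentiable at the point `x` of the space. -/
def HolAt (e e' : OpenPartialHomeomorph X ℂ) (x : X) : Prop :=
  DifferentiableAt ℂ (fun z => e' (e.symm z)) (e x)

/-- The derivative at the point `x` of the space of the change of charts from `e` to `e'`. -/
noncomputable def transDeriv (e e' : OpenPartialHomeomorph X ℂ) (x : X) : ℂ :=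
  deriv (fun z => e' (e.symm z)) (e x)

variable {e e' e'' : OpenPartialHomeomorph X ℂ} {x : X}

lemma mem_trans_source (hx : x ∈ e.source) (hx' : x ∈ e'.source) :
    e x ∈ (e.symm.trans e').source := by
  simp [hx, hx']

lemma HolomorphicTransition.holAt (h : HolomorphicTransition e e') (hx : x ∈ e.source)
    (hx' : x ∈ e'.source) : HolAt e e' x :=
  h.differentiableAt ((e.symm.trans e').open_source.mem_nhds (mem_trans_source hx hx'))

lemma HolomorphicTransition.analyticAt (h : HolomorphicTransition e e') (hx : x ∈ e.source)
    (hx' : x ∈ e'.source) : AnalyticAt ℂ (fun z => e' (e.symm z)) (e x) :=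
  DifferentiableOn.analyticAt h ((e.symm.trans e').open_source.mem_nhds (mem_trans_source hx hx'))

lemma holomorphicTransition_of_holAt (h : ∀ x ∈ e.source, x ∈ e'.source → HolAt e e' x) :
    HolomorphicTransition e e' := by
  intro z hz
  have h1 : z ∈ e.target := hz.1
  have := h (e.symm z) (e.map_target h1) hz.2
  rw [HolAt, e.right_inv h1] at this
  exact this.differentiableWithinAt

lemma eventually_comp_trans_eq (hx : x ∈ e.source) (hx' : x ∈ e'.source) :
    (fun z => e'' (e.symm z)) =ᶠ[𝓝 (e x)]
      (fun z => e'' (e'.symm z)) ∘ fun z => e' (e.symm z) := by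
  filter_upwards [(e.symm.trans e').open_source.mem_nhds (mem_trans_source hx hx')] with z hz
  simp only [Function.comp]
  rw [e'.left_inv (show e.symm z ∈ e'.source from hz.2)]

lemma HolAt.trans (h : HolAt e e' x) (h' : HolAt e' e'' x) (hx : x ∈ e.source)
    (hx' : x ∈ e'.source) : HolAt e e'' x := by
  refine DifferentiableAt.congr_of_eventuallyEq ?_ (eventually_comp_trans_eq hx hx')
  refine DifferentiableAt.comp (e x) ?_ h
  rw [e.left_inv hx]
  exact h'

lemma transDeriv_trans (h : HolAt e e' x) (h' : HolAt e' e'' x) (hx : x ∈ e.source)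
    (hx' : x ∈ e'.source) : transDeriv e e'' x = transDeriv e' e'' x * transDeriv e e' x := by
  unfold transDeriv
  have h2 : DifferentiableAt ℂ (fun z => e'' (e'.symm z)) (e' (e.symm (e x))) := by
    rw [e.left_inv hx]; exact h'
  rw [(eventually_comp_trans_eq hx hx').deriv_eq, deriv_comp (e x) h2 h, e.left_inv hx]

lemma transDeriv_self (hx : x ∈ e.source) : transDeriv e e x = 1 := by
  have : (fun z => e (e.symm z)) =ᶠ[𝓝 (e x)] id := by
    filter_upwards [e.open_target.mem_nhds (e.map_source hx)] with z hz
    exact e.right_inv hz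
  rw [transDeriv, this.deriv_eq, deriv_id]

lemma transDeriv_mul_transDeriv (h : HolAt e e' x) (h' : HolAt e' e x) (hx : x ∈ e.source)
    (hx' : x ∈ e'.source) : transDeriv e' e x * transDeriv e e' x = 1 := by
  rw [← transDeriv_trans h h' hx hx', transDeriv_self hx]

lemma HolAt.symm (h : HolAt e e' x) (h0 : transDeriv e e' x ≠ 0) (hx : x ∈ e.source)
    (hx' : x ∈ e'.source) : HolAt e' e x := by
  have h1 := (e.symm.trans e').hasDerivAt_symm (a := e' x) (f' := transDeriv e e' x)
    (by simp [hx, hx']) h0 (by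
      have : (e.symm.trans e').symm (e' x) = e x := by simp [hx']
      rw [this]
      exact h.hasDerivAt)
  exact h1.differentiableAt

lemma continuousAt_trans (hx : x ∈ e.source) (hx' : x ∈ e'.source) :
    ContinuousAt (fun z => e' (e.symm z)) (e x) :=
  (e.symm.trans e').continuousAt (mem_trans_source hx hx')

/-- The image in a chart of a punctured neighbourhood is a punctured neighbourhood. -/
lemma eventually_nhdsNE_symm (hx : x ∈ e.source) {P : X → Prop} (h : ∀ᶠ y in 𝓝[≠] x, P y) :
    ∀ᶠ z in 𝓝[≠] (e x), z ∈ e.target ∧ P (e.symm z) := by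
  rw [eventually_nhdsWithin_iff] at h ⊢
  have hc := e.continuousAt_symm (e.map_source hx)
  rw [ContinuousAt, e.left_inv hx] at hc
  filter_upwards [hc.eventually h, e.open_target.mem_nhds (e.map_source hx)] with z hz hzt hne
  refine ⟨hzt, hz fun heq => hne ?_⟩
  rw [mem_singleton_iff] at heq ⊢
  rw [← heq, e.right_inv hzt]

/-- Removable singularities: a change of charts that is holomorphic on a punctured neighbourhood
is holomorphic. -/
lemma HolAt.of_eventually_nhdsNE (hx : x ∈ e.source) (hx' : x ∈ e'.source)
    (h : ∀ᶠ y in 𝓝[≠] x, HolAt e e' y) : HolAt e e' x := by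
  refine (Complex.analyticAt_of_differentiable_on_punctured_nhds_of_continuousAt ?_
    (continuousAt_trans hx hx')).differentiableAt
  filter_upwards [eventually_nhdsNE_symm hx h] with z hz
  have := hz.2
  rwa [HolAt, e.right_inv hz.1] at this

lemma Set.Finite.eventually_nhdsNE_notMem [T1Space X] {S : Set X} (hS : S.Finite) (x : X) :
    ∀ᶠ y in 𝓝[≠] x, y ∉ S := by
  rw [eventually_nhdsWithin_iff]
  filter_upwards [(hS.subset (sdiff_subset (t := {x}))).isClosed.isOpen_compl.mem_nhds
    (fun h => h.2 rfl : x ∈ (S \ {x})ᶜ)] with y hy hne hyS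
  exact hy ⟨hyS, hne⟩

lemma eventually_nhdsNE_mem_source (hx : x ∈ e.source) : ∀ᶠ y in 𝓝[≠] x, y ∈ e.source :=
  nhdsWithin_le_nhds (e.open_source.mem_nhds hx)

lemma KTranslationTransition.holAt {k : ℕ} (h : KTranslationTransition k e e')
    (hx : x ∈ e.source) (hx' : x ∈ e'.source) : HolAt e e' x := by
  obtain ⟨r, c, hrc⟩ := h (e x) (mem_trans_source hx hx')
  exact DifferentiableAt.congr_of_eventuallyEq (by fun_prop) hrc

lemma KTranslationTransition.transDeriv_pow {k : ℕ} (hk : 0 < k)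
    (h : KTranslationTransition k e e') (hx : x ∈ e.source) (hx' : x ∈ e'.source) :
    transDeriv e e' x ^ k = 1 := by
  obtain ⟨r, c, hrc⟩ := h (e x) (mem_trans_source hx hx')
  have h1 : deriv (fun w => Complex.exp (2 * Real.pi * Complex.I / k) ^ r * w + c) (e x) =
      Complex.exp (2 * Real.pi * Complex.I / k) ^ r := by
    simp
  rw [transDeriv, Filter.EventuallyEq.deriv_eq hrc, h1, exp_two_pi_I_div_zpow_pow hk]

/-- A holomorphic change of charts whose derivative is a `k`-th root of unity at every point is
locally of the form `z ↦ ζ ^ r * z + c`. -/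
lemma kTranslationTransition_of_transDeriv_pow {k : ℕ} (hk : 0 < k)
    (h : HolomorphicTransition e e')
    (h1 : ∀ x ∈ e.source, x ∈ e'.source → transDeriv e e' x ^ k = 1) :
    KTranslationTransition k e e' := by
  intro z hz
  obtain ⟨δ, hδ, hball⟩ := Metric.isOpen_iff.1 (e.symm.trans e').open_source z hz
  obtain ⟨ω, b, hω, hb⟩ := exists_eq_mul_add_of_pow_deriv_eq hk (P := id) Metric.isOpen_ball
    ((convex_ball z δ).isConnected ⟨z, Metric.mem_ball_self hδ⟩) (h.mono hball)
    differentiableOn_id (fun y _ => by simp) (by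
      intro y hy
      have hy1 : y ∈ e.target := (hball hy).1
      have := h1 (e.symm y) (e.map_target hy1) (hball hy).2
      rw [transDeriv, e.right_inv hy1] at this
      rw [this, deriv_id, one_pow])
  have : NeZero k := ⟨hk.ne'⟩
  obtain ⟨i, -, hi⟩ := (Complex.isPrimitiveRoot_exp k hk.ne').eq_pow_of_pow_eq_one hω
  refine ⟨i, b, ?_⟩
  filter_upwards [Metric.ball_mem_nhds z hδ] with w hw
  rw [hb w hw, zpow_natCast, hi, id]

/-- A chart belongs to a maximal holomorphic atlas as soon as it is compatible, outside a finite
set, with some chart of the atlas around each point. -/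
lemma IsMaximalAtlas.mem_of_holAt [T1Space X] {A : Set (OpenPartialHomeomorph X ℂ)}
    (hA : IsMaximalAtlas univ HolomorphicTransition A) {S : Set X} (hS : S.Finite)
    (h : ∀ x ∈ e.source, x ∉ S → ∃ e' ∈ A, x ∈ e'.source ∧ HolAt e e' x ∧ HolAt e' e x) :
    e ∈ A := by
  refine hA.maximal e (subset_univ _) fun e'' he'' => ⟨?_, ?_⟩
  · refine holomorphicTransition_of_holAt fun x hx hx'' => HolAt.of_eventually_nhdsNE hx hx'' ?_
    filter_upwards [hS.eventually_nhdsNE_notMem x, eventually_nhdsNE_mem_source hx,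
      eventually_nhdsNE_mem_source hx''] with y h1 h2 h3
    obtain ⟨e', he', hy', h4, -⟩ := h y h2 h1
    exact h4.trans ((hA.compatible e' he' e'' he'').holAt hy' h3) h2 hy'
  · refine holomorphicTransition_of_holAt fun x hx'' hx => HolAt.of_eventually_nhdsNE hx'' hx ?_
    filter_upwards [hS.eventually_nhdsNE_notMem x, eventually_nhdsNE_mem_source hx,
      eventually_nhdsNE_mem_source hx''] with y h1 h2 h3
    obtain ⟨e', he', hy', -, h4⟩ := h y h2 h1
    exact ((hA.compatible e'' he'' e' he').holAt h3 hy').trans h4 h3 hy'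

/-! ### Local properties of `k`-differentials -/

/-- The pullback of a meromorphic function in normal form, as a coefficient of a `k`-differential,
under a biholomorphic change of coordinate is in normal form. -/
lemma MeromorphicNFAt.comp_mul_deriv_pow {f τ : ℂ → ℂ} {z : ℂ} (hτ : AnalyticAt ℂ τ z)
    (h0 : deriv τ z ≠ 0) (hf : MeromorphicNFAt f (τ z)) (k : ℕ) :
    MeromorphicNFAt (fun w => f (τ w) * deriv τ w ^ k) z := by
  have h1 : MeromorphicNFAt (f ∘ τ) z := (meromorphicNFAt_comp_iff_of_deriv_ne_zero hτ h0).2 hf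
  exact (meromorphicNFAt_mul_iff_left (hτ.deriv.pow k) (pow_ne_zero _ h0)).2 h1

lemma meromorphicOrderAt_comp_mul_deriv_pow {f τ : ℂ → ℂ} {z : ℂ} (hτ : AnalyticAt ℂ τ z)
    (h0 : deriv τ z ≠ 0) (k : ℕ) :
    meromorphicOrderAt (fun w => f (τ w) * deriv τ w ^ k) z = meromorphicOrderAt f (τ z) := by
  have h1 : (fun w => f (τ w) * deriv τ w ^ k) = (fun w => deriv τ w ^ k) * (f ∘ τ) := by
    funext w; simp [mul_comm]
  rw [h1, meromorphicOrderAt_mul_of_ne_zero (g := fun w => deriv τ w ^ k) (hτ.deriv.pow k)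
    (pow_ne_zero _ h0),
    meromorphicOrderAt_comp_of_deriv_ne_zero hτ h0]

lemma meromorphicOrderAt_const_mul_zpow {f : ℂ → ℂ} {c : ℂ} (hc : c ≠ 0) {m : ℤ} {z₀ : ℂ}
    (h : ∀ᶠ z in 𝓝[≠] z₀, f z = c * (z - z₀) ^ m) : MeromorphicAt f z₀ ∧
      meromorphicOrderAt f z₀ = m := by
  have hf : MeromorphicAt f z₀ :=
    MeromorphicAt.congr (f := fun z => c * (z - z₀) ^ m) (by fun_prop)
      (h.mono fun z hz => hz.symm)
  refine ⟨hf, (meromorphicOrderAt_eq_int_iff hf).2 ⟨fun _ => c, analyticAt_const, hc, ?_⟩⟩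
  filter_upwards [h] with z hz
  rw [hz, smul_eq_mul, mul_comm]

namespace KDifferential

variable {k : ℕ} (D : KDifferential k X)

lemma holomorphicTransition (he : e ∈ D.atlas) (he' : e' ∈ D.atlas) : HolomorphicTransition e e' :=
  D.isMaximalAtlas.compatible e he e' he'

lemma holAt (he : e ∈ D.atlas) (he' : e' ∈ D.atlas) (hx : x ∈ e.source) (hx' : x ∈ e'.source) :
    HolAt e e' x :=
  (D.holomorphicTransition he he').holAt hx hx'

lemma transDeriv_ne_zero (he : e ∈ D.atlas) (he' : e' ∈ D.atlas) (hx : x ∈ e.source)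
    (hx' : x ∈ e'.source) : transDeriv e e' x ≠ 0 :=
  right_ne_zero_of_mul_eq_one
    (transDeriv_mul_transDeriv (D.holAt he he' hx hx') (D.holAt he' he hx' hx) hx hx')

lemma coeff_apply (he : e ∈ D.atlas) (he' : e' ∈ D.atlas) (hx : x ∈ e.source)
    (hx' : x ∈ e'.source) :
    D.coeff e (e x) = D.coeff e' (e' x) * transDeriv e e' x ^ k := by
  have := D.transform e he e' he' (e x) (mem_trans_source hx hx')
  rwa [e.left_inv hx] at this

lemma exists_chart_at (x : X) : ∃ e ∈ D.atlas, x ∈ e.source :=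
  D.isMaximalAtlas.cover x (mem_univ x)

lemma meromorphicNFAt (he : e ∈ D.atlas) (hx : x ∈ e.source) :
    MeromorphicNFAt (D.coeff e) (e x) :=
  D.meromorphic e he (e.map_source hx)

lemma meromorphicOrderAt_eq (he : e ∈ D.atlas) (he' : e' ∈ D.atlas) (hx : x ∈ e.source)
    (hx' : x ∈ e'.source) :
    meromorphicOrderAt (D.coeff e) (e x) = meromorphicOrderAt (D.coeff e') (e' x) := by
  have h1 := (D.holomorphicTransition he he').analyticAt hx hx'
  have h2 := meromorphicOrderAt_comp_mul_deriv_pow (f := D.coeff e') h1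
    (D.transDeriv_ne_zero he he' hx hx') k
  rw [e.left_inv hx] at h2
  rw [← h2]
  refine meromorphicOrderAt_congr (nhdsWithin_le_nhds ?_)
  filter_upwards [(e.symm.trans e').open_source.mem_nhds (mem_trans_source hx hx')] with z hz
  exact D.transform e he e' he' z hz

lemma hasOrder_iff (he : e ∈ D.atlas) (hx : x ∈ e.source) {m : ℤ} :
    D.HasOrder x m ↔ meromorphicOrderAt (D.coeff e) (e x) = m :=
  ⟨fun h => h e he hx, fun h e' he' hx' => by rw [D.meromorphicOrderAt_eq he' he hx' hx, h]⟩

lemma HasOrder.unique {D : KDifferential k X} {m m' : ℤ} (h : D.HasOrder x m)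
    (h' : D.HasOrder x m') : m = m' := by
  obtain ⟨e, he, hx⟩ := D.exists_chart_at x
  have := (h e he hx).symm.trans (h' e he hx)
  exact_mod_cast this

lemma hasOrder_zero_iff (he : e ∈ D.atlas) (hx : x ∈ e.source) :
    D.HasOrder x 0 ↔ D.coeff e (e x) ≠ 0 := by
  rw [D.hasOrder_iff he hx]
  exact (D.meromorphicNFAt he hx).meromorphicOrderAt_eq_zero_iff

/-- Around a point of order `n - k` the `k`-differential is `(n / k) ^ k * u ^ (n - k) * (du) ^ k`
in a suitable holomorphic chart `u`. -/
lemma exists_normalForm_chart [T1Space X] (hk : 0 < k) {n : ℕ} (hn : 0 < n) {p : X}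
    (hp : D.HasOrder p ((n : ℤ) - k)) {W : Set X} (hW : W ∈ 𝓝 p) :
    ∃ u ∈ D.atlas, p ∈ u.source ∧ u.source ⊆ W ∧ u p = 0 ∧
      ∀ z ∈ u.target, z ≠ 0 → D.coeff u z = ((n : ℂ) / k) ^ k * z ^ ((n : ℤ) - k) := by
  obtain ⟨e, he, hpe⟩ := D.exists_chart_at p
  obtain ⟨v, hv, hv0, hv', hform⟩ := exists_normalForm_coordinate hk hn
    (D.meromorphicNFAt he hpe).meromorphicAt (hp e he hpe)
  have hc := e.continuousAt_symm (e.map_source hpe)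
  rw [ContinuousAt, e.left_inv hpe] at hc
  obtain ⟨ψ, hpψ, hsub, hψv, hψd, hψs⟩ := hv.exists_openPartialHomeomorph hv'
    (Filter.inter_mem (eventually_nhdsWithin_iff.1 hform) (hc hW))
  set u := e.trans ψ with hu
  have hsrc : ∀ x ∈ u.source, x ∈ e.source ∧ e x ∈ ψ.source := fun x hx => by
    simpa [hu] using hx
  have hux : ∀ x, u x = v (e x) := fun x => by simp [hu, hψv]
  have hue : ∀ x ∈ u.source, (fun z => u (e.symm z)) =ᶠ[𝓝 (e x)] v := fun x hx => by
    filter_upwards [e.open_target.mem_nhds (e.map_source (hsrc x hx).1)] with z hz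
    rw [hux, e.right_inv hz]
  have htd : ∀ x ∈ u.source, transDeriv e u x = deriv v (e x) := fun x hx =>
    (hue x hx).deriv_eq
  have hhol : ∀ x ∈ u.source, HolAt e u x := fun x hx =>
    (hψd _ (hsrc x hx).2).1.congr_of_eventuallyEq (hue x hx)
  have huA : u ∈ D.atlas := by
    refine D.isMaximalAtlas.mem_of_holAt finite_empty fun x hx _ =>
      ⟨e, he, (hsrc x hx).1, ?_, hhol x hx⟩
    refine (hhol x hx).symm ?_ (hsrc x hx).1 hx
    rw [htd x hx]
    exact (hψd _ (hsrc x hx).2).2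
  refine ⟨u, huA, by simp [hu, hpe, hpψ], fun x hx => ?_, by rw [hux, hv0], ?_⟩
  · have := (hsub (hsrc x hx).2).2
    rwa [mem_preimage, e.left_inv (hsrc x hx).1] at this
  · intro z hz hz0
    obtain ⟨x, hx, rfl⟩ : ∃ x ∈ u.source, u x = z :=
      ⟨_, u.map_target hz, u.right_inv hz⟩
    have h1 := D.coeff_apply he huA (hsrc x hx).1 hx
    have hne : e x ≠ e p := fun h => hz0 (by rw [hux, h, hv0])
    rw [(hsub (hsrc x hx).2).1 hne, htd x hx, ← hux] at h1
    exact (mul_right_cancel₀ (pow_ne_zero _ (hψd _ (hsrc x hx).2).2) h1).symm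

end KDifferential

end

/-! ### The `k`-differential that induces a translation structure -/

section

variable {X : Type*} [TopologicalSpace X]

namespace IsConeChart

variable {k n : ℕ} {S : Set X} {A : Set (OpenPartialHomeomorph X ℂ)} {p x : X} {c : ℂ}
  {u e : OpenPartialHomeomorph X ℂ}

lemma map_ne_zero (hu : IsConeChart k n S A p c u) (hx : x ∈ u.source) (hxp : x ≠ p) : u x ≠ 0 :=
  fun h => hxp (u.injOn hx hu.mem_source (h.trans hu.map_eq_zero.symm))

lemma holAt (hu : IsConeChart k n S A p c u) (he : e ∈ A) (hx : x ∈ u.source)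
    (hxe : x ∈ e.source) (hxp : x ≠ p) : HolAt u e x :=
  hu.differentiableAt e he (u x) (u.map_source hx) (hu.map_ne_zero hx hxp)
    (by rwa [u.left_inv hx])

lemma transDeriv_pow (hu : IsConeChart k n S A p c u) (he : e ∈ A) (hx : x ∈ u.source)
    (hxe : x ∈ e.source) (hxp : x ≠ p) : transDeriv u e x ^ k = c * u x ^ ((n : ℤ) - k) :=
  hu.pow_deriv e he (u x) (u.map_source hx) (hu.map_ne_zero hx hxp) (by rwa [u.left_inv hx])

lemma holAt_symm (hk : 0 < k) (hu : IsConeChart k n S A p c u) (he : e ∈ A) (hx : x ∈ u.source)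
    (hxe : x ∈ e.source) (hxp : x ≠ p) : HolAt e u x := by
  refine (hu.holAt he hx hxe hxp).symm (fun h0 => ?_) hx hxe
  have := hu.transDeriv_pow he hx hxe hxp
  rw [h0, zero_pow hk.ne'] at this
  exact mul_ne_zero hu.ne_zero (zpow_ne_zero _ (hu.map_ne_zero hx hxp)) this.symm

end IsConeChart

namespace TranslationSurface

variable {k : ℕ} (T : TranslationSurface k X) {e e' : OpenPartialHomeomorph X ℂ} {x : X}

lemma source_subset (he : e ∈ T.atlas) : e.source ⊆ T.singᶜ := T.isMaximalAtlas.source_subset e he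

lemma exists_chart_at (hx : x ∉ T.sing) : ∃ e ∈ T.atlas, x ∈ e.source :=
  T.isMaximalAtlas.cover x hx

/-- The holomorphic charts of the surface: the charts that are compatible with the translation
charts. -/
def holAtlas : Set (OpenPartialHomeomorph X ℂ) :=
  {e | ∀ e' ∈ T.atlas, HolomorphicTransition e e' ∧ HolomorphicTransition e' e}

lemma atlas_subset_holAtlas : T.atlas ⊆ T.holAtlas := fun e he e' he' =>
  ⟨holomorphicTransition_of_holAt fun _ hx hx' =>
      (T.isMaximalAtlas.compatible e he e' he').holAt hx hx',
    holomorphicTransition_of_holAt fun _ hx hx' =>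
      (T.isMaximalAtlas.compatible e' he' e he).holAt hx hx'⟩

lemma transDeriv_ne_zero (he : e ∈ T.holAtlas) (he' : e' ∈ T.atlas) (hx : x ∈ e.source)
    (hx' : x ∈ e'.source) : transDeriv e e' x ≠ 0 :=
  right_ne_zero_of_mul_eq_one (transDeriv_mul_transDeriv ((he e' he').1.holAt hx hx')
    ((he e' he').2.holAt hx' hx) hx hx')

/-- The `k`-th power of the derivative of a translation chart does not depend on the chart. -/
lemma transDeriv_pow_eq (hk : 0 < k) {e'' : OpenPartialHomeomorph X ℂ} (he : e ∈ T.holAtlas)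
    (he' : e' ∈ T.atlas) (he'' : e'' ∈ T.atlas) (hx : x ∈ e.source) (hx' : x ∈ e'.source)
    (hx'' : x ∈ e''.source) : transDeriv e e' x ^ k = transDeriv e e'' x ^ k := by
  rw [transDeriv_trans ((he e'' he'').1.holAt hx hx'')
    ((T.isMaximalAtlas.compatible e'' he'' e' he').holAt hx'' hx') hx hx'', mul_pow,
    (T.isMaximalAtlas.compatible e'' he'' e' he').transDeriv_pow hk hx'' hx', one_mul]

lemma mem_holAtlas_of_holAt [T1Space X] {S : Set X} (hS : S.Finite)
    (h : ∀ x ∈ e.source, x ∉ S → ∀ e' ∈ T.atlas, x ∈ e'.source → HolAt e e' x ∧ HolAt e' e x) :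
    e ∈ T.holAtlas := by
  refine fun e' he' => ⟨holomorphicTransition_of_holAt fun x hx hx' => ?_,
    holomorphicTransition_of_holAt fun x hx' hx => ?_⟩
  · refine HolAt.of_eventually_nhdsNE hx hx' ?_
    filter_upwards [hS.eventually_nhdsNE_notMem x, eventually_nhdsNE_mem_source hx,
      eventually_nhdsNE_mem_source hx'] with y h1 h2 h3
    exact (h y h2 h1 e' he' h3).1
  · refine HolAt.of_eventually_nhdsNE hx' hx ?_
    filter_upwards [hS.eventually_nhdsNE_notMem x, eventually_nhdsNE_mem_source hx,
      eventually_nhdsNE_mem_source hx'] with y h1 h2 h3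
    exact (h y h2 h1 e' he' h3).2

lemma _root_.IsConeChart.mem_holAtlas [T1Space X] (hk : 0 < k) {n : ℕ} {p : X} {c : ℂ}
    {u : OpenPartialHomeomorph X ℂ} (hu : IsConeChart k n T.sing T.atlas p c u) :
    u ∈ T.holAtlas := by
  refine T.mem_holAtlas_of_holAt (finite_singleton p) fun x hx hxp e' he' hx' => ?_
  exact ⟨hu.holAt he' hx hx' hxp, hu.holAt_symm hk he' hx hx' hxp⟩

lemma holAtlas_compatible [T1Space X] (he : e ∈ T.holAtlas) (he' : e' ∈ T.holAtlas) :
    HolomorphicTransition e e' := by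
  refine holomorphicTransition_of_holAt fun x hx hx' => HolAt.of_eventually_nhdsNE hx hx' ?_
  filter_upwards [T.sing_finite.eventually_nhdsNE_notMem x, eventually_nhdsNE_mem_source hx,
    eventually_nhdsNE_mem_source hx'] with y h1 h2 h3
  obtain ⟨e'', he'', hy⟩ := T.exists_chart_at h1
  exact ((he e'' he'').1.holAt h2 hy).trans ((he' e'' he'').2.holAt hy h3) h2 hy

lemma isMaximalAtlas_holAtlas [T1Space X] (hk : 0 < k) :
    IsMaximalAtlas univ HolomorphicTransition T.holAtlas where
  source_subset _ _ := subset_univ _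
  cover x _ := by
    by_cases hx : x ∈ T.sing
    · obtain ⟨n, hn⟩ := T.isConePoint x hx
      obtain ⟨c, u, hu⟩ := hn.exists_isConeChart hk T.isMaximalAtlas
      exact ⟨u, hu.mem_holAtlas T hk, hu.mem_source⟩
    · obtain ⟨e, he, hxe⟩ := T.exists_chart_at hx
      exact ⟨e, T.atlas_subset_holAtlas he, hxe⟩
  compatible _ he _ he' := T.holAtlas_compatible he he'
  maximal _ _ h := fun e' he' => h e' (T.atlas_subset_holAtlas he')

open Classical in
/-- The coefficient of the induced `k`-differential in a holomorphic chart `e`, away from the cone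
points: the `k`-th power of the derivative of any translation chart. The value at the cone points
is irrelevant. -/
noncomputable def coeffAux (e : OpenPartialHomeomorph X ℂ) (z : ℂ) : ℂ :=
  if h : e.symm z ∈ T.sing then 0
  else transDeriv e (T.exists_chart_at h).choose (e.symm z) ^ k

lemma coeffAux_apply (hk : 0 < k) (he : e ∈ T.holAtlas) (he' : e' ∈ T.atlas) (hx : x ∈ e.source)
    (hx' : x ∈ e'.source) : T.coeffAux e (e x) = transDeriv e e' x ^ k := by
  have hxe := e.left_inv hx
  have hxS : e.symm (e x) ∉ T.sing := by
    rw [hxe]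
    exact T.source_subset he' hx'
  rw [coeffAux, dif_neg hxS]
  obtain ⟨h1, h2⟩ := (T.exists_chart_at hxS).choose_spec
  rw [T.transDeriv_pow_eq hk he h1 he' (by rwa [hxe]) h2 (by rwa [hxe]), hxe]

lemma coeffAux_trans [T1Space X] (hk : 0 < k) (he : e ∈ T.holAtlas) (he' : e' ∈ T.holAtlas)
    (hx : x ∈ e.source) (hx' : x ∈ e'.source) (hxS : x ∉ T.sing) :
    T.coeffAux e (e x) = T.coeffAux e' (e' x) * transDeriv e e' x ^ k := by
  obtain ⟨e'', he'', hx''⟩ := T.exists_chart_at hxS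
  rw [T.coeffAux_apply hk he he'' hx hx'', T.coeffAux_apply hk he' he'' hx' hx'', ← mul_pow,
    transDeriv_trans ((T.holAtlas_compatible he he').holAt hx hx')
      ((he' e'' he'').1.holAt hx' hx'') hx hx']

lemma coeffAux_trans_eventuallyEq [T1Space X] (hk : 0 < k) (he : e ∈ T.holAtlas)
    (he' : e' ∈ T.holAtlas) (hx : x ∈ e.source) (hx' : x ∈ e'.source) :
    T.coeffAux e =ᶠ[𝓝[≠] (e x)] fun z =>
      T.coeffAux e' (e' (e.symm z)) * deriv (fun w => e' (e.symm w)) z ^ k := by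
  filter_upwards [eventually_nhdsNE_symm hx ((T.sing_finite.eventually_nhdsNE_notMem x).and
    (eventually_nhdsNE_mem_source hx'))] with z hz
  have := T.coeffAux_trans hk he he' (e.map_target hz.1) hz.2.2 hz.2.1
  rwa [transDeriv, e.right_inv hz.1] at this

lemma analyticAt_coeffAux (hk : 0 < k) (he : e ∈ T.holAtlas) (he' : e' ∈ T.atlas)
    (hx : x ∈ e.source) (hx' : x ∈ e'.source) : AnalyticAt ℂ (T.coeffAux e) (e x) := by
  have h1 := ((he e' he').1.analyticAt hx hx').deriv.pow k
  refine h1.congr ?_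
  filter_upwards [(e.symm.trans e').open_source.mem_nhds (mem_trans_source hx hx')] with z hz
  have := T.coeffAux_apply hk he he' (e.map_target hz.1) (show e.symm z ∈ e'.source from hz.2)
  rw [transDeriv, e.right_inv hz.1] at this
  exact this.symm

lemma _root_.IsConeChart.coeffAux_eq (hk : 0 < k) [T1Space X] {n : ℕ} {p : X} {c : ℂ}
    {u : OpenPartialHomeomorph X ℂ} (hu : IsConeChart k n T.sing T.atlas p c u) {z : ℂ}
    (hz : z ∈ u.target) (hz0 : z ≠ 0) : T.coeffAux u z = c * z ^ ((n : ℤ) - k) := by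
  obtain ⟨x, hx, rfl⟩ : ∃ x ∈ u.source, u x = z := ⟨_, u.map_target hz, u.right_inv hz⟩
  have hxp : x ≠ p := fun h => hz0 (h ▸ hu.map_eq_zero)
  obtain ⟨e, he, hxe⟩ := T.exists_chart_at fun h => hxp (hu.source_inter_subset ⟨hx, h⟩)
  rw [T.coeffAux_apply hk (hu.mem_holAtlas T hk) he hx hxe, hu.transDeriv_pow he hx hxe hxp]

lemma meromorphicAt_coeffAux [T1Space X] (hk : 0 < k) (he : e ∈ T.holAtlas) (hx : x ∈ e.source) :
    MeromorphicAt (T.coeffAux e) (e x) := by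
  by_cases hxS : x ∈ T.sing
  · obtain ⟨n, hn⟩ := T.isConePoint x hxS
    obtain ⟨c, u, hu⟩ := hn.exists_isConeChart hk T.isMaximalAtlas
    have huA := hu.mem_holAtlas T hk
    have h1 : MeromorphicAt (T.coeffAux u) (u x) := by
      refine (meromorphicOrderAt_const_mul_zpow hu.ne_zero (m := (n : ℤ) - k) ?_).1
      filter_upwards [nhdsWithin_le_nhds (u.open_target.mem_nhds (u.map_source hu.mem_source)),
        self_mem_nhdsWithin] with z hz hz0
      rw [hu.map_eq_zero] at hz0 ⊢
      rw [sub_zero, hu.coeffAux_eq T hk hz hz0]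
    have hτ := (T.holAtlas_compatible he huA).analyticAt hx hu.mem_source
    have h2 : MeromorphicAt (fun z => T.coeffAux u (u (e.symm z))) (e x) := by
      refine MeromorphicAt.comp_analyticAt (f := T.coeffAux u) ?_ hτ
      rwa [e.left_inv hx]
    exact (h2.mul (hτ.deriv.pow k).meromorphicAt).congr
      (T.coeffAux_trans_eventuallyEq hk he huA hx hu.mem_source).symm
  · obtain ⟨e', he', hx'⟩ := T.exists_chart_at hxS
    exact (T.analyticAt_coeffAux hk he he' hx hx').meromorphicAt

lemma meromorphicOn_coeffAux [T1Space X] (hk : 0 < k) (he : e ∈ T.holAtlas) :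
    MeromorphicOn (T.coeffAux e) e.target := fun z hz => by
  have := T.meromorphicAt_coeffAux hk he (e.map_target hz)
  rwa [e.right_inv hz] at this

open Classical in
/-- The normalised coefficient of the induced `k`-differential. -/
noncomputable def coeff (e : OpenPartialHomeomorph X ℂ) (z : ℂ) : ℂ :=
  if e ∈ T.holAtlas ∧ z ∈ e.target then toMeromorphicNFOn (T.coeffAux e) e.target z else 0

lemma coeff_of_mem (he : e ∈ T.holAtlas) {z : ℂ} (hz : z ∈ e.target) :
    T.coeff e z = toMeromorphicNFOn (T.coeffAux e) e.target z := if_pos ⟨he, hz⟩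

lemma meromorphicNFAt_coeff (he : e ∈ T.holAtlas) {z : ℂ} (hz : z ∈ e.target) :
    MeromorphicNFAt (T.coeff e) z := by
  refine (meromorphicNFAt_congr ?_).2
    (meromorphicNFOn_toMeromorphicNFOn (T.coeffAux e) e.target hz)
  filter_upwards [e.open_target.mem_nhds hz] with w hw
  exact T.coeff_of_mem he hw

lemma coeff_eventuallyEq [T1Space X] (hk : 0 < k) (he : e ∈ T.holAtlas) {z : ℂ}
    (hz : z ∈ e.target) : T.coeff e =ᶠ[𝓝[≠] z] T.coeffAux e := by
  filter_upwards [(T.meromorphicOn_coeffAux hk he).toMeromorphicNFOn_eq_self_on_nhdsNE hz,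
    nhdsWithin_le_nhds (e.open_target.mem_nhds hz)] with w h1 h2
  rw [T.coeff_of_mem he h2, ← h1]

lemma coeff_apply [T1Space X] (hk : 0 < k) (he : e ∈ T.holAtlas) (he' : e' ∈ T.atlas)
    (hx : x ∈ e.source) (hx' : x ∈ e'.source) : T.coeff e (e x) = transDeriv e e' x ^ k := by
  have h1 := (T.meromorphicNFAt_coeff he (e.map_source
    hx)).eventuallyEq_nhdsNE_iff_eventuallyEq_nhds
    (T.analyticAt_coeffAux hk he he' hx hx').meromorphicNFAt
  rw [(h1.1 (T.coeff_eventuallyEq hk he (e.map_source hx))).eq_of_nhds,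
    T.coeffAux_apply hk he he' hx hx']

lemma coeff_transform [T1Space X] (hk : 0 < k) (he : e ∈ T.holAtlas) (he' : e' ∈ T.holAtlas)
    (hx : x ∈ e.source) (hx' : x ∈ e'.source) :
    T.coeff e (e x) = T.coeff e' (e' x) * transDeriv e e' x ^ k := by
  have hτ := (T.holAtlas_compatible he he').analyticAt hx hx'
  have hτ0 : deriv (fun z => e' (e.symm z)) (e x) ≠ 0 :=
    right_ne_zero_of_mul_eq_one (transDeriv_mul_transDeriv
      ((T.holAtlas_compatible he he').holAt hx hx')
      ((T.holAtlas_compatible he' he).holAt hx' hx) hx hx')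
  have h1 : MeromorphicNFAt (fun z => T.coeff e' (e' (e.symm z)) *
      deriv (fun w => e' (e.symm w)) z ^ k) (e x) :=
    MeromorphicNFAt.comp_mul_deriv_pow (f := T.coeff e') hτ hτ0 (by
      rw [e.left_inv hx]; exact T.meromorphicNFAt_coeff he' (e'.map_source hx')) k
  -- Away from the cone points both sides are given by the translation charts.
  have h2 : T.coeff e =ᶠ[𝓝[≠] (e x)] fun z => T.coeff e' (e' (e.symm z)) *
      deriv (fun w => e' (e.symm w)) z ^ k := by
    filter_upwards [eventually_nhdsNE_symm hx ((T.sing_finite.eventually_nhdsNE_notMem x).and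
      (eventually_nhdsNE_mem_source hx'))] with z ⟨hz, hzS, hz'⟩
    have hy := e.map_target hz
    obtain ⟨e'', he'', hz''⟩ := T.exists_chart_at hzS
    have h3 := T.coeff_apply hk he he'' hy hz''
    have h4 := T.coeff_apply hk he' he'' hz' hz''
    have h5 := transDeriv_trans ((T.holAtlas_compatible he he').holAt hy hz')
      ((he' e'' he'').1.holAt hz' hz'') hy hz'
    rw [h5, mul_pow, ← h4, transDeriv, e.right_inv hz] at h3
    exact h3
  have h6 := (((T.meromorphicNFAt_coeff he
    (e.map_source hx)).eventuallyEq_nhdsNE_iff_eventuallyEq_nhds h1).1 h2).eq_of_nhds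
  simp only [e.left_inv hx] at h6
  exact h6

/-- A space covered by charts up to a finite set of cone points has a regular point. -/
lemma exists_notMem_sing [T1Space X] [Nonempty X] (hk : 0 < k) : ∃ x, x ∉ T.sing := by
  obtain ⟨x⟩ := ‹Nonempty X›
  obtain ⟨e, he, hx⟩ := (T.isMaximalAtlas_holAtlas hk).cover x (mem_univ x)
  have := eventually_nhdsNE_symm hx (T.sing_finite.eventually_nhdsNE_notMem x)
  obtain ⟨z, -, hz⟩ := this.exists
  exact ⟨_, hz⟩

/-- The `k`-differential that induces the translation structure. -/
noncomputable def toKDifferential [T1Space X] [Nonempty X] (hk : 0 < k) : KDifferential k X where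
  atlas := T.holAtlas
  coeff := T.coeff
  isMaximalAtlas := T.isMaximalAtlas_holAtlas hk
  meromorphic _ he _ hz := T.meromorphicNFAt_coeff he hz
  transform e he e' he' z hz := by
    have := T.coeff_transform hk he he' (e.map_target hz.1)
      (show e.symm z ∈ e'.source from hz.2)
    rwa [transDeriv, e.right_inv hz.1] at this
  coeff_eq_zero e z h := if_neg fun h' => h.elim (fun h => h h'.1) fun h => h h'.2
  ne_zero := by
    obtain ⟨x, hx⟩ := T.exists_notMem_sing hk
    obtain ⟨e, he, hxe⟩ := T.exists_chart_at hx
    refine ⟨e, T.atlas_subset_holAtlas he, e x, e.map_source hxe, ?_⟩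
    rw [T.coeff_apply hk (T.atlas_subset_holAtlas he) he hxe hxe, transDeriv_self hxe, one_pow]
    exact one_ne_zero

/-- Holomorphic charts whose derivative with respect to the translation charts is a `k`-th root of
unity are translation charts. -/
lemma mem_atlas_of_transDeriv_pow (hk : 0 < k) (he : e ∈ T.holAtlas) (heS : e.source ⊆ T.singᶜ)
    (h : ∀ e' ∈ T.atlas, ∀ x ∈ e.source, x ∈ e'.source → transDeriv e e' x ^ k = 1) :
    e ∈ T.atlas := by
  refine T.isMaximalAtlas.maximal e heS fun e' he' => ⟨?_, ?_⟩
  · exact kTranslationTransition_of_transDeriv_pow hk (he e' he').1 (h e' he')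
  · refine kTranslationTransition_of_transDeriv_pow hk (he e' he').2 fun x hx' hx => ?_
    have := transDeriv_mul_transDeriv ((he e' he').1.holAt hx hx')
      ((he e' he').2.holAt hx' hx) hx hx'
    have h1 := congrArg (· ^ k) this
    simpa only [mul_pow, h e' he' x hx hx', mul_one, one_pow] using h1

lemma isInducedBy_toKDifferential [T1Space X] [Nonempty X] (hk : 0 < k) :
    T.IsInducedBy (T.toKDifferential hk) := by
  ext e
  constructor
  · intro he
    refine ⟨T.atlas_subset_holAtlas he, T.source_subset he, fun z hz => ?_⟩
    have hx := e.map_target hz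
    have := T.coeff_apply hk (T.atlas_subset_holAtlas he) he hx hx
    rwa [transDeriv_self hx, one_pow, e.right_inv hz] at this
  · rintro ⟨he, heS, h1⟩
    refine T.mem_atlas_of_transDeriv_pow hk he heS fun e' he' x hx hx' => ?_
    rw [← T.coeff_apply hk he he' hx hx']
    exact h1 _ (e.map_source hx)

/-! ### Properties of an induced structure -/

variable {T} {D : KDifferential k X}

lemma IsInducedBy.mem_atlas (h : T.IsInducedBy D) (he : e ∈ T.atlas) : e ∈ D.atlas := by
  rw [IsInducedBy] at h
  rw [h] at he
  exact he.1

lemma IsInducedBy.coeff_eq_one (h : T.IsInducedBy D) (he : e ∈ T.atlas) (hx : x ∈ e.source) :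
    D.coeff e (e x) = 1 := by
  rw [IsInducedBy] at h
  rw [h] at he
  exact he.2.2 _ (e.map_source hx)

lemma IsInducedBy.coeff_apply (h : T.IsInducedBy D) (he : e ∈ D.atlas) (he' : e' ∈ T.atlas)
    (hx : x ∈ e.source) (hx' : x ∈ e'.source) : D.coeff e (e x) = transDeriv e e' x ^ k := by
  rw [D.coeff_apply he (h.mem_atlas he') hx hx', h.coeff_eq_one he' hx', one_mul]

/-- The Riemann surface structure is determined by the translation structure. -/
lemma IsInducedBy.atlas_eq [T1Space X] (h : T.IsInducedBy D) : D.atlas = T.holAtlas := by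
  ext e
  refine ⟨fun he e' he' => ⟨D.holomorphicTransition he (h.mem_atlas he'),
    D.holomorphicTransition (h.mem_atlas he') he⟩, fun he => ?_⟩
  refine D.isMaximalAtlas.mem_of_holAt T.sing_finite fun x hx hxS => ?_
  obtain ⟨e', he', hx'⟩ := T.exists_chart_at hxS
  exact ⟨e', h.mem_atlas he', hx', (he e' he').1.holAt hx hx', (he e' he').2.holAt hx' hx⟩

/-- Two `k`-differentials whose coefficients in charts with the same target agree outside the cone
points have the same coefficients in these charts. -/
lemma _root_.KDifferential.coeff_eq_of_notMem [T1Space X] {Y : Type*} [TopologicalSpace Y]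
    {D : KDifferential k X} {D' : KDifferential k Y} {d : OpenPartialHomeomorph Y ℂ}
    (he : e ∈ D.atlas) (hd : d ∈ D'.atlas) (htarget : e.target = d.target) {S : Set X}
    (hS : S.Finite) (h : ∀ x ∈ e.source, x ∉ S → D.coeff e (e x) = D'.coeff d (e x)) {z : ℂ}
    (hz : z ∈ e.target) : D.coeff e z = D'.coeff d z := by
  refine Filter.EventuallyEq.eq_of_nhds (((D.meromorphic e he
    hz).eventuallyEq_nhdsNE_iff_eventuallyEq_nhds (D'.meromorphic d hd (htarget ▸ hz))).1 ?_)
  have hx := e.map_target hz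
  have := eventually_nhdsNE_symm hx (hS.eventually_nhdsNE_notMem (e.symm z))
  rw [e.right_inv hz] at this
  filter_upwards [this] with w hw
  have := h _ (e.map_target hw.1) hw.2
  rwa [e.right_inv hw.1] at this

/-- The `k`-differential is determined by the translation structure. -/
lemma IsInducedBy.unique [T1Space X] {D' : KDifferential k X} (h : T.IsInducedBy D)
    (h' : T.IsInducedBy D') : D = D' := by
  have hA : D.atlas = D'.atlas := h.atlas_eq.trans h'.atlas_eq.symm
  refine KDifferential.ext hA ?_
  funext e z
  by_cases hez : e ∈ D.atlas ∧ z ∈ e.target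
  · obtain ⟨he, hz⟩ := hez
    refine KDifferential.coeff_eq_of_notMem he (hA ▸ he) rfl T.sing_finite (fun x hx hxS => ?_) hz
    obtain ⟨e', he', hx'⟩ := T.exists_chart_at hxS
    rw [h.coeff_apply he he' hx hx', h'.coeff_apply (hA ▸ he) he' hx hx']
  · rw [not_and_or] at hez
    rw [D.coeff_eq_zero e z hez, D'.coeff_eq_zero e z (hA ▸ hez)]

lemma IsInducedBy.hasOrder_zero (h : T.IsInducedBy D) (hx : x ∉ T.sing) : D.HasOrder x 0 := by
  obtain ⟨e, he, hxe⟩ := T.exists_chart_at hx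
  rw [D.hasOrder_zero_iff (h.mem_atlas he) hxe, h.coeff_eq_one he hxe]
  exact one_ne_zero

/-- In the conformal coordinate `u` of a cone point of angle `2 π n / k`, the translation charts
are `u ^ (n / k)` up to constants, so the order is `n - k`. -/
lemma IsInducedBy.hasOrder_of_isConePoint [T1Space X] (hk : 0 < k) (h : T.IsInducedBy D) {p : X}
    {n : ℕ} (hp : IsConePoint k T.sing T.atlas p n) : D.HasOrder p ((n : ℤ) - k) := by
  obtain ⟨c, u, hu⟩ := hp.exists_isConeChart hk T.isMaximalAtlas
  have huD : u ∈ D.atlas := h.atlas_eq ▸ hu.mem_holAtlas T hk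
  rw [D.hasOrder_iff huD hu.mem_source]
  refine (meromorphicOrderAt_const_mul_zpow hu.ne_zero ?_).2
  filter_upwards [nhdsWithin_le_nhds (u.open_target.mem_nhds (u.map_source hu.mem_source)),
    self_mem_nhdsWithin] with z hz hz0
  rw [hu.map_eq_zero] at hz0 ⊢
  obtain ⟨x, hx, rfl⟩ : ∃ x ∈ u.source, u x = z := ⟨_, u.map_target hz, u.right_inv hz⟩
  have hxp : x ≠ p := fun h => hz0 (h ▸ hu.map_eq_zero)
  obtain ⟨e, he, hxe⟩ := T.exists_chart_at fun h => hxp (hu.source_inter_subset ⟨hx, h⟩)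
  rw [sub_zero, h.coeff_apply huD he hx hxe, hu.transDeriv_pow he hx hxe hxp]

lemma IsInducedBy.poleOrdersLE [T1Space X] (hk : 0 < k) (h : T.IsInducedBy D) :
    D.PoleOrdersLE := by
  intro p e he hpe
  by_cases hp : p ∈ T.sing
  · obtain ⟨n, hn⟩ := T.isConePoint p hp
    rw [h.hasOrder_of_isConePoint hk hn e he hpe]
    have := hn.1
    exact_mod_cast (by omega : -((k : ℤ) - 1) ≤ (n : ℤ) - k)
  · rw [h.hasOrder_zero hp e he hpe]
    exact_mod_cast (by omega : -((k : ℤ) - 1) ≤ 0)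

lemma IsInducedBy.hasOrder_iff_isConePointOfAngle [T1Space X] (hk : 0 < k) (h : T.IsInducedBy D)
    {p : X} (hp : p ∈ T.sing) (m : ℤ) :
    D.HasOrder p m ↔ T.IsConePointOfAngle p (2 * Real.pi * ((k : ℝ) + m) / k) := by
  have hk0 : (k : ℝ) ≠ 0 := by exact_mod_cast hk.ne'
  have hpi := Real.pi_ne_zero
  constructor
  · intro hm
    obtain ⟨n, hn⟩ := T.isConePoint p hp
    have := hm.unique (h.hasOrder_of_isConePoint hk hn)
    subst this
    exact ⟨n, by push_cast; ring, hn⟩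
  · rintro ⟨n, hα, hn⟩
    have h1 : (k : ℝ) + m = n := by field_simp at hα; exact hα
    have h2 : (k : ℤ) + m = n := by exact_mod_cast h1
    have h3 : m = (n : ℤ) - k := by omega
    rw [h3]
    exact h.hasOrder_of_isConePoint hk hn

/-- A translation structure is determined by its cone points and the `k`-differential. -/
lemma IsInducedBy.eq_of_sing_eq {T' : TranslationSurface k X} (h : T.IsInducedBy D)
    (h' : T'.IsInducedBy D) (hS : T.sing = T'.sing) : T = T' := by
  refine TranslationSurface.ext hS ?_
  rw [IsInducedBy] at h h'
  rw [h, h', hS]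

end TranslationSurface

end

/-! ### The translation structure induced by a `k`-differential -/

section

variable {X : Type*} [TopologicalSpace X]

namespace KDifferential

variable {k : ℕ} (D : KDifferential k X) {e e' : OpenPartialHomeomorph X ℂ} {x : X}

/-- If `p` has a punctured neighbourhood without zeros and poles, then the order at `p` is
finite. -/
lemma exists_hasOrder_of_eventually {p : X} (h : ∀ᶠ y in 𝓝[≠] p, D.HasOrder y 0) :
    ∃ m : ℤ, D.HasOrder p m := by
  obtain ⟨e, he, hpe⟩ := D.exists_chart_at p
  have hne : meromorphicOrderAt (D.coeff e) (e p) ≠ ⊤ := by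
    rw [meromorphicOrderAt_ne_top_iff_eventually_ne_zero
      (D.meromorphicNFAt he hpe).meromorphicAt]
    filter_upwards [eventually_nhdsNE_symm hpe h] with z hz
    have := (D.hasOrder_zero_iff he (e.map_target hz.1)).1 hz.2
    rwa [e.right_inv hz.1] at this
  obtain ⟨m, hm⟩ := WithTop.ne_top_iff_exists.1 hne
  exact ⟨m, (D.hasOrder_iff he hpe).2 hm.symm⟩

/-- The charts on the complement of `S` in which the `k`-differential is `(dz) ^ k`. -/
def translationAtlas (S : Set X) : Set (OpenPartialHomeomorph X ℂ) :=
  {e | e ∈ D.atlas ∧ e.source ⊆ Sᶜ ∧ ∀ z ∈ e.target, D.coeff e z = 1}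

variable {D} {S : Set X}

lemma transDeriv_pow_of_mem_translationAtlas (he : e ∈ D.translationAtlas S)
    (he' : e' ∈ D.translationAtlas S) (hx : x ∈ e.source) (hx' : x ∈ e'.source) :
    transDeriv e e' x ^ k = 1 := by
  have := D.coeff_apply he.1 he'.1 hx hx'
  rwa [he.2.2 _ (e.map_source hx), he'.2.2 _ (e'.map_source hx'), one_mul, eq_comm] at this

variable [T1Space X]

lemma exists_mem_translationAtlas (hk : 0 < k) (hS : S.Finite)
    (h0 : ∀ p ∉ S, D.HasOrder p 0) {p : X} (hp : p ∉ S) :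
    ∃ e ∈ D.translationAtlas S, p ∈ e.source := by
  have hk0 : (k : ℂ) ≠ 0 := by exact_mod_cast hk.ne'
  obtain ⟨u, hu, hpu, huS, hu0, hcoeff⟩ := D.exists_normalForm_chart hk hk (p := p)
    (by rw [sub_self]; exact h0 p hp) (hS.isClosed.isOpen_compl.mem_nhds hp)
  have h1 : ∀ z ∈ u.target, z ≠ 0 → D.coeff u z = 1 := fun z hz hz0 => by
    rw [hcoeff z hz hz0, div_self hk0, one_pow, sub_self, zpow_zero, one_mul]
  refine ⟨u, ⟨hu, huS, fun z hz => ?_⟩, hpu⟩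
  by_cases hz0 : z = 0
  · -- The value at the centre follows from the normalisation of the coefficient.
    have h2 := ((D.meromorphic u hu hz).eventuallyEq_nhdsNE_iff_eventuallyEq_nhds
      (analyticAt_const (v := (1 : ℂ))).meromorphicNFAt).1 (by
        filter_upwards [nhdsWithin_le_nhds (u.open_target.mem_nhds hz), self_mem_nhdsWithin]
          with w hw hw0
        exact h1 w hw (hz0 ▸ hw0))
    exact h2.eq_of_nhds
  · exact h1 z hz hz0

lemma isMaximalAtlas_translationAtlas (hk : 0 < k) (hS : S.Finite)
    (h0 : ∀ p ∉ S, D.HasOrder p 0) :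
    IsMaximalAtlas Sᶜ (KTranslationTransition k) (D.translationAtlas S) where
  source_subset _ he := he.2.1
  cover _ hp := exists_mem_translationAtlas hk hS h0 hp
  compatible e he e' he' := kTranslationTransition_of_transDeriv_pow hk
    (D.holomorphicTransition he.1 he'.1)
    fun _ hx hx' => transDeriv_pow_of_mem_translationAtlas he he' hx hx'
  maximal e heS h := by
    have heD : e ∈ D.atlas := by
      refine D.isMaximalAtlas.mem_of_holAt finite_empty fun x hx _ => ?_
      obtain ⟨e', he', hx'⟩ := exists_mem_translationAtlas hk hS h0 (heS hx)
      exact ⟨e', he'.1, hx', (h e' he').1.holAt hx hx', (h e' he').2.holAt hx' hx⟩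
    refine ⟨heD, heS, fun z hz => ?_⟩
    have hx := e.map_target hz
    obtain ⟨e', he', hx'⟩ := exists_mem_translationAtlas hk hS h0 (heS hx)
    have := D.coeff_apply heD he'.1 hx hx'
    rwa [he'.2.2 _ (e'.map_source hx'), (h e' he').1.transDeriv_pow hk hx hx', one_mul,
      e.right_inv hz] at this

lemma isConePoint_translationAtlas (hk : 0 < k) (hS : S.Finite) {n : ℕ} (hn : 0 < n) {p : X}
    (hp : D.HasOrder p ((n : ℤ) - k)) : IsConePoint k S (D.translationAtlas S) p n := by
  have hk0 : (k : ℂ) ≠ 0 := by exact_mod_cast hk.ne'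
  have hn0 : (n : ℂ) ≠ 0 := by exact_mod_cast hn.ne'
  obtain ⟨u, hu, hpu, huS, hu0, hcoeff⟩ := D.exists_normalForm_chart hk hn hp
    ((hS.subset (sdiff_subset (t := {p}))).isClosed.isOpen_compl.mem_nhds (fun h => h.2 rfl))
  refine IsConeChart.isConePoint hk hn (u := u) ⟨hpu, hu0, ?_, pow_ne_zero _ (div_ne_zero hn0 hk0),
    ?_, ?_⟩
  · rintro x ⟨hx, hxS⟩
    by_contra hxp
    exact huS hx ⟨hxS, hxp⟩
  · intro e he z hz _ hze
    have := D.holAt hu he.1 (u.map_target hz) hze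
    rwa [HolAt, u.right_inv hz] at this
  · intro e he z hz hz0 hze
    have := D.coeff_apply hu he.1 (u.map_target hz) hze
    rw [he.2.2 _ (e.map_source hze), one_mul, u.right_inv hz, transDeriv, u.right_inv hz] at this
    rw [← this, hcoeff z hz hz0]

variable (D) in
/-- The translation structure induced by a `k`-differential with poles of order less than `k`, with
cone points at the marked points. -/
def toTranslationSurface (hk : 0 < k) (hS : S.Finite) (h0 : ∀ p ∉ S, D.HasOrder p 0)
    (hD : D.PoleOrdersLE) : TranslationSurface k X where
  sing := S
  atlas := D.translationAtlas S
  sing_finite := hS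
  isMaximalAtlas := isMaximalAtlas_translationAtlas hk hS h0
  isConePoint p _ := by
    obtain ⟨m, hm⟩ := D.exists_hasOrder_of_eventually
      ((hS.eventually_nhdsNE_notMem p).mono fun y hy => h0 y hy)
    obtain ⟨e, he, hpe⟩ := D.exists_chart_at p
    have h1 := hD p e he hpe
    rw [hm e he hpe] at h1
    have h2 : -((k : ℤ) - 1) ≤ m := by exact_mod_cast h1
    obtain ⟨n, hn⟩ : ∃ n : ℕ, (n : ℤ) = m + k := ⟨(m + k).toNat, by omega⟩
    refine ⟨n, isConePoint_translationAtlas hk hS (by omega) ?_⟩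
    rwa [hn, add_sub_cancel_right]


end KDifferential

end

/-! ### Finiteness of the zeros and poles -/

section

variable {X : Type*} [TopologicalSpace X] {k : ℕ}

namespace KDifferential

/-- Around a point of finite order there are no other zeros and poles. -/
lemma HasOrder.eventually_hasOrder_zero {D : KDifferential k X} {p : X} {m : ℤ}
    (h : D.HasOrder p m) : ∀ᶠ y in 𝓝[≠] p, D.HasOrder y 0 := by
  obtain ⟨e, he, hpe⟩ := D.exists_chart_at p
  have h1 : ∀ᶠ z in 𝓝[≠] (e p), D.coeff e z ≠ 0 := by
    rw [← meromorphicOrderAt_ne_top_iff_eventually_ne_zero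
      (D.meromorphicNFAt he hpe).meromorphicAt, h e he hpe]
    exact WithTop.coe_ne_top
  rw [eventually_nhdsWithin_iff] at h1 ⊢
  filter_upwards [(e.continuousAt hpe).eventually h1, e.open_source.mem_nhds hpe] with y hy hys hne
  exact (D.hasOrder_zero_iff he hys).2 (hy fun heq => hne (e.injOn hys hpe heq))

/-- On a connected surface the order is finite at every point, by the identity theorem. -/
lemma exists_hasOrder [PreconnectedSpace X] (D : KDifferential k X) (p : X) :
    ∃ m : ℤ, D.HasOrder p m := by
  set G : Set X := {p | ∃ m : ℤ, D.HasOrder p m} with hG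
  have hopen : IsOpen G := by
    rw [isOpen_iff_mem_nhds]
    rintro q ⟨m, hm⟩
    have := eventually_nhdsWithin_iff.1 hm.eventually_hasOrder_zero
    filter_upwards [this] with y hy
    by_cases hyq : y = q
    · exact ⟨m, hyq ▸ hm⟩
    · exact ⟨0, hy hyq⟩
  have hclosed : IsClosed G := by
    rw [← isOpen_compl_iff, isOpen_iff_mem_nhds]
    intro q hq
    obtain ⟨e, he, hqe⟩ := D.exists_chart_at q
    have htop : meromorphicOrderAt (D.coeff e) (e q) = ⊤ := by
      by_contra hne
      obtain ⟨m, hm⟩ := WithTop.ne_top_iff_exists.1 hne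
      exact hq ⟨m, (D.hasOrder_iff he hqe).2 hm.symm⟩
    have h0 : D.coeff e =ᶠ[𝓝 (e q)] fun _ => 0 :=
      ((D.meromorphicNFAt he hqe).eventuallyEq_nhdsNE_iff_eventuallyEq_nhds
        analyticAt_const.meromorphicNFAt).1 (meromorphicOrderAt_eq_top_iff.1 htop)
    filter_upwards [(e.continuousAt hqe).eventually h0.eventually_nhds,
      e.open_source.mem_nhds hqe] with y hy hys
    rintro ⟨m, hm⟩
    have h1 := hm e he hys
    rw [meromorphicOrderAt_eq_top_iff.2 (nhdsWithin_le_nhds hy)] at h1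
    exact WithTop.top_ne_coe h1
  have hne : G.Nonempty := by
    obtain ⟨e, he, z, hz, hz0⟩ := D.ne_zero
    refine ⟨e.symm z, 0, (D.hasOrder_zero_iff he (e.map_target hz)).2 ?_⟩
    rwa [e.right_inv hz]
  have hp : p ∈ G := by
    rw [IsClopen.eq_univ ⟨hclosed, hopen⟩ hne]
    exact mem_univ p
  exact hp

lemma finite_setOf_not_hasOrder_zero [PreconnectedSpace X] [CompactSpace X]
    (D : KDifferential k X) : {p | ¬ D.HasOrder p 0}.Finite := by
  have h : ∀ p, {y | y ≠ p → D.HasOrder y 0} ∈ 𝓝 p := fun p => by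
    obtain ⟨m, hm⟩ := D.exists_hasOrder p
    exact eventually_nhdsWithin_iff.1 hm.eventually_hasOrder_zero
  obtain ⟨t, ht⟩ := CompactSpace.elim_nhds_subcover _ h
  refine t.finite_toSet.subset fun p hp => ?_
  have : p ∈ ⋃ q ∈ t, {y | y ≠ q → D.HasOrder y 0} := ht ▸ mem_univ p
  simp only [mem_iUnion] at this
  obtain ⟨q, hq, hpq⟩ := this
  have : p = q := by
    by_contra hne
    exact hp (hpq hne)
  exact this ▸ hq

end KDifferential

/-! ### Isomorphisms -/

variable {Y : Type*} [TopologicalSpace Y]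

lemma Homeomorph.exists_transOpenPartialHomeomorph_eq (f : X ≃ₜ Y)
    (d : OpenPartialHomeomorph X ℂ) : ∃ e, f.transOpenPartialHomeomorph e = d := by
  refine ⟨f.symm.transOpenPartialHomeomorph d, ?_⟩
  ext x <;> simp

lemma transDeriv_transOpenPartialHomeomorph (f : X ≃ₜ Y) (e e' : OpenPartialHomeomorph Y ℂ)
    (x : X) : transDeriv (f.transOpenPartialHomeomorph e) (f.transOpenPartialHomeomorph e') x =
      transDeriv e e' (f x) := by
  simp [transDeriv]

lemma holomorphicTransition_transOpenPartialHomeomorph_iff (f : X ≃ₜ Y)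
    (e e' : OpenPartialHomeomorph Y ℂ) :
    HolomorphicTransition (f.transOpenPartialHomeomorph e) (f.transOpenPartialHomeomorph e') ↔
      HolomorphicTransition e e' := by
  have h : ((f.transOpenPartialHomeomorph e).symm.trans
      (f.transOpenPartialHomeomorph e')).source = (e.symm.trans e').source := by
    ext z; simp
  unfold HolomorphicTransition
  rw [h]
  simp

namespace TranslationSurface

variable {T : TranslationSurface k X} {D : KDifferential k X}
  {T' : TranslationSurface k Y} {D' : KDifferential k Y} {f : X ≃ₜ Y}

lemma IsIso.mem_holAtlas_iff (hf : T.IsIso T' f) (e : OpenPartialHomeomorph Y ℂ) :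
    e ∈ T'.holAtlas ↔ f.transOpenPartialHomeomorph e ∈ T.holAtlas := by
  constructor
  · intro he d hd
    obtain ⟨e', rfl⟩ := f.exists_transOpenPartialHomeomorph_eq d
    rw [holomorphicTransition_transOpenPartialHomeomorph_iff,
      holomorphicTransition_transOpenPartialHomeomorph_iff]
    exact he e' ((hf.2 e').2 hd)
  · intro he e' he'
    have := he _ ((hf.2 e').1 he')
    rwa [holomorphicTransition_transOpenPartialHomeomorph_iff,
      holomorphicTransition_transOpenPartialHomeomorph_iff] at this

lemma IsInducedBy.isIso_iff [T1Space X] [T1Space Y] (h : T.IsInducedBy D)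
    (h' : T'.IsInducedBy D') (f : X ≃ₜ Y) :
    T.IsIso T' f ↔ f '' T.sing = T'.sing ∧ D.IsIso D' f := by
  constructor
  · intro hf
    have hA : ∀ e : OpenPartialHomeomorph Y ℂ,
        e ∈ D'.atlas ↔ f.transOpenPartialHomeomorph e ∈ D.atlas := fun e => by
      rw [h.atlas_eq, h'.atlas_eq, hf.mem_holAtlas_iff]
    refine ⟨hf.1, hA, fun e he z hz => ?_⟩
    refine KDifferential.coeff_eq_of_notMem ((hA e).1 he) he rfl T.sing_finite
      (fun x hx hxS => ?_) hz
    have hfx : f x ∉ T'.sing := by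
      rw [← hf.1]
      rintro ⟨y, hy, hyx⟩
      exact hxS (f.injective hyx ▸ hy)
    obtain ⟨e', he', hx'⟩ := T'.exists_chart_at hfx
    have h1 := h.coeff_apply ((hA e).1 he) ((hf.2 e').1 he') hx hx'
    have h2 := h'.coeff_apply (x := f x) he he' hx hx'
    rw [transDeriv_transOpenPartialHomeomorph, ← h2] at h1
    exact h1
  · rintro ⟨hS, hA, hcoeff⟩
    refine ⟨hS, fun e => ?_⟩
    rw [IsInducedBy] at h h'
    rw [h, h']
    have hsource : e.source ⊆ T'.singᶜ ↔ (f.transOpenPartialHomeomorph e).source ⊆ T.singᶜ := by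
      rw [← hS, ← f.image_compl]
      constructor
      · intro hsub x hx
        obtain ⟨y, hy, hyx⟩ := hsub (show f x ∈ e.source from hx)
        exact f.injective hyx ▸ hy
      · intro hsub y hy
        exact ⟨f.symm y, hsub (by simpa using hy), f.apply_symm_apply y⟩
    constructor
    · rintro ⟨h1, h2, h3⟩
      exact ⟨(hA e).1 h1, hsource.1 h2, fun z hz => (hcoeff e h1 z hz).trans (h3 z hz)⟩
    · rintro ⟨h1, h2, h3⟩
      have h1' := (hA e).2 h1
      exact ⟨h1', hsource.2 h2, fun z hz => (hcoeff e h1' z hz).symm.trans (h3 z hz)⟩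

end TranslationSurface

end

/-! ### The correspondence -/

theorem mainTheorem8 (k : ℕ) (hk : 0 < k)
    (X : Type*) [TopologicalSpace X] [T2Space X] [CompactSpace X] [ConnectedSpace X] :
    -- surfaces with a finite set `S` of cone points <-> `k`-differentials with marked points `S`
    (∃ Φ : TranslationSurface k X ≃
        {D : PointedKDifferential k X // D.toKDifferential.PoleOrdersLE},
      ∀ T : TranslationSurface k X,
        T.sing = (Φ T).1.marked ∧ T.IsInducedBy (Φ T).1.toKDifferential) ∧
    -- surfaces all of whose cone points are genuine <-> `k`-differentials
    (∃ Ψ : {T : TranslationSurface k X //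
          ∀ p ∈ T.sing, ¬ T.IsConePointOfAngle p (2 * Real.pi)} ≃
        {D : KDifferential k X // D.PoleOrdersLE},
      ∀ T, T.1.sing = {p | ¬ (Ψ T).1.HasOrder p 0} ∧ T.1.IsInducedBy (Ψ T).1) ∧
    -- orders and cone angles
    (∀ (T : TranslationSurface k X) (D : KDifferential k X), T.IsInducedBy D →
      ∀ p ∈ T.sing, ∀ m : ℤ,
        D.HasOrder p m ↔ T.IsConePointOfAngle p (2 * Real.pi * ((k : ℝ) + m) / k)) ∧
    -- the correspondence respects isomorphisms
    (∀ (Y : Type*) [TopologicalSpace Y] [T2Space Y] [CompactSpace Y] [ConnectedSpace Y]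
      (T : TranslationSurface k X) (D : KDifferential k X)
      (T' : TranslationSurface k Y) (D' : KDifferential k Y),
      T.IsInducedBy D → T'.IsInducedBy D' → ∀ f : X ≃ₜ Y,
        T.IsIso T' f ↔ f '' T.sing = T'.sing ∧ D.IsIso D' f) := by
  have hk0 : (k : ℝ) ≠ 0 := by exact_mod_cast hk.ne'
  have hind : ∀ T : TranslationSurface k X, T.IsInducedBy (T.toKDifferential hk) :=
    fun T => T.isInducedBy_toKDifferential hk
  have hind' : ∀ (D : KDifferential k X) (S : Set X) (hS : S.Finite)
      (h0 : ∀ p ∉ S, D.HasOrder p 0) (hD : D.PoleOrdersLE),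
      (D.toTranslationSurface hk hS h0 hD).IsInducedBy D := fun _ _ _ _ _ => rfl
  -- The cone angle `2 π` means order `0`.
  have hangle : ∀ (T : TranslationSurface k X) (D : KDifferential k X), T.IsInducedBy D →
      ∀ p ∈ T.sing, (D.HasOrder p 0 ↔ T.IsConePointOfAngle p (2 * Real.pi)) := by
    intro T D h p hp
    rw [h.hasOrder_iff_isConePointOfAngle hk hp 0, Int.cast_zero, add_zero,
      mul_div_cancel_right₀ _ hk0]
  have hsing : ∀ T : {T : TranslationSurface k X //
      ∀ p ∈ T.sing, ¬ T.IsConePointOfAngle p (2 * Real.pi)},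
      T.1.sing = {p | ¬ (T.1.toKDifferential hk).HasOrder p 0} := by
    intro T
    ext p
    refine ⟨fun hp h => T.2 p hp ((hangle _ _ (hind T.1) p hp).1 h),
      fun hp => by_contra fun hpS => hp ((hind T.1).hasOrder_zero hpS)⟩
  refine ⟨⟨⟨fun T => ⟨⟨T.toKDifferential hk, T.sing, T.sing_finite,
      fun _ hp => (hind T).hasOrder_zero hp⟩, (hind T).poleOrdersLE hk⟩,
      fun D => D.1.toTranslationSurface hk D.1.marked_finite D.1.hasOrder_zero D.2, ?_, ?_⟩,
      fun T => ⟨rfl, hind T⟩⟩,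
    ⟨⟨fun T => ⟨T.1.toKDifferential hk, (hind T.1).poleOrdersLE hk⟩,
      fun D => ⟨D.1.toTranslationSurface hk (S := {p | ¬ D.1.HasOrder p 0})
        D.1.finite_setOf_not_hasOrder_zero (fun _ hp => not_not.1 hp) D.2, ?_⟩, ?_, ?_⟩, ?_⟩,
    fun T D h p hp m => h.hasOrder_iff_isConePointOfAngle hk hp m,
    fun Y _ _ _ _ T D T' D' h h' f => h.isIso_iff h' f⟩
  · intro T
    exact (hind' _ _ _ _ _).eq_of_sing_eq (hind T) rfl
  · rintro ⟨⟨D, S, hS, h0⟩, hD⟩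
    have := (hind _).unique (hind' D S hS h0 hD)
    refine Subtype.ext (PointedKDifferential.ext ?_ ?_ rfl)
    · exact congrArg KDifferential.atlas this
    · exact congrArg KDifferential.coeff this
  · intro p hp
    rw [← hangle _ _ (hind' _ _ _ _ _) p hp]
    exact hp
  · intro T
    exact Subtype.ext ((hind' (T.1.toKDifferential hk) _
      (T.1.toKDifferential hk).finite_setOf_not_hasOrder_zero (fun _ hp => not_not.1 hp)
      ((hind T.1).poleOrdersLE hk)).eq_of_sing_eq (hind T.1) (hsing T).symm)
  · intro D
    exact Subtype.ext ((hind _).unique (hind' D.1 _ D.1.finite_setOf_not_hasOrder_zero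
      (fun _ hp => not_not.1 hp) D.2))
  · exact fun T => ⟨hsing T, hind T.1⟩
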